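/- Let $\{\mathbf X_{n,k}=(X_{n,k}^{(1)},X_{n,k}^{(2)}):1\le k\le n,\ n\ge 1\}$ be a triangular array of bivariate random vectors such that, for each $n$, the $2n$ variables of row $n$ are jointly Gaussian with mean zero and unit variance, with $$\operatorname{corr}(X_{n,k}^{(1)},X_{n,k}^{(2)})=\rho_0(n),\qquad \operatorname{corr}(X_{n,k}^{(i)},X_{n,l}^{(j)})=\rho_{ij}(|k-l|,n)\quad(1\le k\ne l\le n,\ i,j\in\{1,2\}).$$ Assume that $\sigma:=\sup_{n\ge2,\,1\le k<n,\,i,j\in\{1,2\}}|\rho_{ij}(k,n)|<1$ and that, for some $\alpha\in\bigl(0,\tfrac{1-\sigma}{1+\sigma}\bigr)$, $$\lim_{n\to\infty}\ \max_{\lfloor n^\alpha\rfloor\le k<n,\ i,j\in\{1,2\}}|\rho_{ij}(k,n)|\,\ln n=0 .$$ Assume further that $\lim_{n\to\infty}(1-\rho_0(n))\ln n=\lambda^2$ for some $\lambda\in[0,\infty]$ and, in the case $\lambda=\infty$, also that $(1+\rho_0(n))\ln n\to\infty$ (for $\lambda<\infty$ this holds automatically). Let $u_n(s)=a_ns+b_n$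 with $a_n=(2\ln n)^{-1/2}$ and $b_n=\sqrt{2\ln n}-\frac{\ln(4\pi\ln n)}{2\sqrt{2\ln n}}$, and let $M_n^{(i)}=\max_{1\le k\le n}X_{n,k}^{(i)}$, $m_n^{(i)}=\min_{1\le k\le n}X_{n,k}^{(i)}$. For $0<\lambda<\infty$ let $$H_\lambda(x,y)=\exp\Bigl(-\Phi\bigl(\lambda+\tfrac{x-y}{2\lambda}\bigr)e^{-y}-\Phi\bigl(\lambda+\tfrac{y-x}{2\lambda}\bigr)e^{-x}\Bigr),$$ where $\Phi$ is the standard normal distribution function, and let $H_0(x,y)=\min(\Lambda(x),\Lambda(y))$ and $H_\infty(x,y)=\Lambda(x)\Lambda(y)$, where $\Lambda(x)=\exp(-e^{-x})$. Then $$\lim_{n\to\infty}\ \sup_{x_1,x_2,y_1,y_2\in\mathbb R}\Bigl|\,\mathbb P\bigl(-u_n(y_i)<m_n^{(i)}\le M_n^{(i)}\le u_n(x_i),\ i=1,2\bigr)-H_\lambda(x_1,x_2)\,H_\lambda(y_1,y_2)\Bigr|=0 .$$ That is, the normalized componentwise maxima and componentwise minima are asymptotically independent. -/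

import Mathlib

open Filter Topology MeasureTheory ProbabilityTheory
open scoped ENNReal NNReal

/-- The standard Gaussian distribution function `Φ`. -/
noncomputable def stdNormalCDF (x : ℝ) : ℝ := cdf (gaussianReal 0 1) x

/-- The Gumbel distribution function `Λ(x) = exp (-exp (-x))`. -/
noncomputable def gumbelCDF (x : ℝ) : ℝ := Real.exp (-Real.exp (-x))

/-- The bivariate Hüsler-Reiss distribution function `H_λ`, `λ ∈ [0, ∞]`, with
`H_0 (x, y) = min (Λ x) (Λ y)` and `H_∞ (x, y) = Λ x * Λ y`. -/
noncomputable def huslerReissCDF (lam : ℝ≥0∞) (x y : ℝ) : ℝ :=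
  if lam = 0 then min (gumbelCDF x) (gumbelCDF y)
  else if lam = ⊤ then gumbelCDF x * gumbelCDF y
  else Real.exp
    (-stdNormalCDF (lam.toReal + (x - y) / (2 * lam.toReal)) * Real.exp (-y)
      - stdNormalCDF (lam.toReal + (y - x) / (2 * lam.toReal)) * Real.exp (-x))

/-- `a_n = 1 / √(2 ln n)`. -/
noncomputable def scaleConst (n : ℕ) : ℝ := 1 / √(2 * Real.log n)

/-- `b_n = √(2 ln n) - ln (4 π ln n) / (2 √(2 ln n))`. -/
noncomputable def locConst (n : ℕ) : ℝ :=
  √(2 * Real.log n) - 1 / (2 * √(2 * Real.log n)) * Real.log (4 * Real.pi * Real.log n)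

/-- `u_n(s) = a_n s + b_n`. -/
noncomputable def normLevel (n : ℕ) (s : ℝ) : ℝ := scaleConst n * s + locConst n

/-- A triangular array of bivariate Gaussian vectors: row `n` consists of the vectors
`(X n k 0, X n k 1)`, `k : Fin n`; each row is jointly Gaussian, all entries are centred with
unit variance (so covariances are correlations), the two components of one vector have
correlation `ρ₀ n`, and `X n k i`, `X n l j` with `k ≠ l` have correlation `ρ i j |k - l| n`.
Nothing is assumed about the dependence between different rows. -/
structure IsStationaryGaussianArray {Ω : Type*} [MeasurableSpace Ω] (P : Measure Ω)
    (X : (n : ℕ) → Fin n → Fin 2 → Ω → ℝ) (ρ₀ : ℕ → ℝ)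
    (ρ : Fin 2 → Fin 2 → ℕ → ℕ → ℝ) : Prop where
  gaussian : ∀ n : ℕ, HasGaussianLaw (fun ω (p : Fin n × Fin 2) => X n p.1 p.2 ω) P
  mean_zero : ∀ (n : ℕ) (k : Fin n) (i : Fin 2), ∫ ω, X n k i ω ∂P = 0
  unit_variance : ∀ (n : ℕ) (k : Fin n) (i : Fin 2), variance (X n k i) P = 1
  corr_same : ∀ (n : ℕ) (k : Fin n), covariance (X n k 0) (X n k 1) P = ρ₀ n
  corr_lag : ∀ (n : ℕ) (k l : Fin n) (i j : Fin 2), k ≠ l →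
    covariance (X n k i) (X n l j) P = ρ i j (((k : ℕ) : ℤ) - ((l : ℕ) : ℤ)).natAbs n

/-- `max { |ρ_ij(k, n)| : ⌊n^α⌋ ≤ k < n, i, j ∈ {1, 2} }`. The index set is non-empty
for `n ≥ 2` and `0 < α < 1`. -/
noncomputable def maxLateCorr (ρ : Fin 2 → Fin 2 → ℕ → ℕ → ℝ) (α : ℝ) (n : ℕ) : ℝ≥0 :=
  (Finset.Ico ⌊(n : ℝ) ^ α⌋₊ n).sup fun k =>
    Finset.univ.sup fun p : Fin 2 × Fin 2 => ‖ρ p.1 p.2 k n‖₊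

/-- The weak dependence (Berman type) condition: `σ = sup |ρ_ij(k, n)| < 1`, and for some
`α ∈ (0, (1 - σ) / (1 + σ))` one has `max_{⌊n^α⌋ ≤ k < n, i, j} |ρ_ij(k, n)| ln n → 0`. -/
def WeakDependence (ρ : Fin 2 → Fin 2 → ℕ → ℕ → ℝ) : Prop :=
  ∃ σ α : ℝ,
    IsLUB {r : ℝ | ∃ (n k : ℕ) (i j : Fin 2), 2 ≤ n ∧ 1 ≤ k ∧ k < n ∧ r = |ρ i j k n|} σ ∧
    σ < 1 ∧ 0 < α ∧ α < (1 - σ) / (1 + σ) ∧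
    Tendsto (fun n : ℕ => (maxLateCorr ρ α n : ℝ) * Real.log n) atTop (𝓝 0)

/-- The Hüsler-Reiss condition `(1 - ρ₀(n)) ln n → λ²` in `[0, ∞]`. For a correlation `ρ₀(n)`
the left side is non-negative, so that `ENNReal.ofReal` does not truncate. -/
def HuslerReissCondition (ρ₀ : ℕ → ℝ) (lam : ℝ≥0∞) : Prop :=
  Tendsto (fun n : ℕ => ENNReal.ofReal ((1 - ρ₀ n) * Real.log n)) atTop (𝓝 (lam ^ 2))

/-- The sample maximum of the `i`-th components of row `n` (a true maximum when `n ≥ 1`). -/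
noncomputable def rowMax {Ω : Type*} (X : (n : ℕ) → Fin n → Fin 2 → Ω → ℝ)
    (n : ℕ) (i : Fin 2) (ω : Ω) : ℝ := ⨆ k : Fin n, X n k i ω

/-- The sample minimum of the `i`-th components of row `n` (a true minimum when `n ≥ 1`). -/
noncomputable def rowMin {Ω : Type*} (X : (n : ℕ) → Fin n → Fin 2 → Ω → ℝ)
    (n : ℕ) (i : Fin 2) (ω : Ω) : ℝ := ⨅ k : Fin n, X n k i ω

/-! The proof has two halves. In the first, row `n` is replaced by `n` independent normal pairs with
correlation `ρ₀ n`. Along the segment between the two covariance matrices, the expectation of a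
product of smooth cutoffs changes at the rate `½ ∑ (Λ₁ - Λ₀) i j` times an expectation in which only
the factors `i` and `j` are differentiated. These derivatives live near the levels `±u_n`, so a
bound on the bivariate normal density yields Berman's sum of `|r| exp (-w² / (1 + |r|))`
(`normal_comparison`). Only correlations between different vectors enter, and these stay below `σ <
1`; `ρ₀ n` is left untouched and may tend to `1`. The interpolation runs through characteristic
functions, so singular covariance matrices are allowed. In the sum, lags below `n^α` give about
`n^(1+α)` terms of size `n^(-2/(1+σ))` up to powers of `ln n`, and the condition on `α` makes them
negligible; the other lags give at most order `n²` terms of size `o(1 / ln n) · ln n / n²`.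

In the second half the probability is the `n`-th power of one rectangle probability. The complement
of the rectangle is the union of an upper and a lower event. Negation preserves the law of the pair,
so both are the same tail computation: given `ξ₁ = u_n(z)`, with `z` distributed asymptotically as
`e^{-z} dz`, the position of `ξ₂` relative to `u_n(y)` is decided by whether `2λw ≤ y - z + 2λ²`,
with `w` standard normal (`tailLimit`). The two events occur together only if the components are
extreme in opposite directions, which has probability `o(1/n)` because `(1 + ρ₀ n) ln n → ∞`. Hence
the exponents add and maxima decouple from minima (`HuslerReissCondition.tendsto_bivLaw_rect_pow`).
Pólya's argument makes the convergence uniform, the limit being continuous. -/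

/-! ### Fourier representations of test functions -/

/-- `φ` is the (inverse) Fourier transform of `ψ`, and `φ'` that of `ξ ↦ i ξ ψ ξ`. -/
structure HasFourierRep (φ φ' : ℝ → ℝ) (ψ : ℝ → ℂ) : Prop where
  integrable : Integrable ψ
  integrable_mul : Integrable fun ξ : ℝ => Complex.I * ξ * ψ ξ
  eq_integral : ∀ x : ℝ, (φ x : ℂ) = ∫ ξ : ℝ, ψ ξ * Complex.exp (Complex.I * (ξ * x : ℝ))
  deriv_eq_integral : ∀ x : ℝ,
    (φ' x : ℂ) = ∫ ξ : ℝ, Complex.I * ξ * ψ ξ * Complex.exp (Complex.I * (ξ * x : ℝ))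

open FourierTransform in
-- Fourier inversion after the substitution `ξ = 2πv`, which replaces the kernel `exp (2πivx)` by
-- `exp (iξx)`, the kernel of characteristic functions.
lemma SchwartzMap.eq_integral_fourier_scaled (f : SchwartzMap ℝ ℂ) (x : ℝ) :
    f x = ∫ ξ : ℝ, ((2 * Real.pi)⁻¹ * 𝓕 f ((2 * Real.pi)⁻¹ * ξ)) *
      Complex.exp (Complex.I * (ξ * x : ℝ)) := by
  have h1 : f x = ∫ v : ℝ, Complex.exp (Complex.I * (2 * Real.pi * v * x : ℝ)) * 𝓕 f v := by
    have : f x = (𝓕⁻ (𝓕 f)) x := by rw [fourierInv_fourier_eq]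
    rw [this, SchwartzMap.fourierInv_coe, Real.fourierInv_eq']
    refine integral_congr_ae (ae_of_all _ fun v => ?_)
    simp only [smul_eq_mul, RCLike.inner_apply, conj_trivial]
    congr 2
    push_cast; ring
  have h2 := MeasureTheory.Measure.integral_comp_mul_left
    (fun v : ℝ => Complex.exp (Complex.I * (2 * Real.pi * v * x : ℝ)) * 𝓕 f v) ((2 * Real.pi)⁻¹)
  rw [h1]
  have hpi : (0:ℝ) < 2 * Real.pi := by positivity
  rw [inv_inv, abs_of_pos hpi] at h2
  have h3 : ∫ v : ℝ, Complex.exp (Complex.I * (2 * Real.pi * v * x : ℝ)) * 𝓕 f v =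
     ((2 * Real.pi)⁻¹ : ℂ) * ∫ v : ℝ, Complex.exp (Complex.I *
      (2 * Real.pi * ((2 * Real.pi)⁻¹ * v) * x : ℝ)) * 𝓕 f ((2 * Real.pi)⁻¹ * v) := by
    rw [h2, Complex.real_smul, ← mul_assoc]
    push_cast
    rw [inv_mul_cancel₀, one_mul]
    exact_mod_cast hpi.ne'
  rw [h3, ← integral_const_mul]
  refine integral_congr_ae (ae_of_all _ fun v => ?_)
  simp only
  have : (2 * Real.pi * ((2 * Real.pi)⁻¹ * v) * x : ℝ) = v * x := by
    field_simp
  have h4 : ((2 * Real.pi : ℝ) : ℂ) = 2 * Real.pi := by push_cast; rfl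
  rw [this, Complex.ofReal_inv, h4]; ring

open FourierTransform in
/-- Smooth compactly supported functions have Fourier representations. -/
lemma HasCompactSupport.exists_hasFourierRep {φ : ℝ → ℝ} (hc : HasCompactSupport φ)
    (hs : ContDiff ℝ (⊤ : ℕ∞) φ) : ∃ ψ, HasFourierRep φ (deriv φ) ψ := by
  set g : ℝ → ℂ := fun x => (φ x : ℂ) with hg
  have hgc : HasCompactSupport g := hc.comp_left (g := fun x : ℝ => (x : ℂ)) (by simp)
  have hgs : ContDiff ℝ (⊤ : ℕ∞) g := Complex.ofRealCLM.contDiff.comp hs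
  let f : SchwartzMap ℝ ℂ := hgc.toSchwartzMap hgs
  have hf : ∀ x, f x = φ x := fun x => rfl
  have hgd : ∀ x, deriv g x = (deriv φ x : ℝ) := by
    intro x
    have hd : HasDerivAt φ (deriv φ x) x :=
      ((hs.differentiable (by simp)) x).hasDerivAt
    exact hd.ofReal_comp.deriv
  have hfd : ∀ x, SchwartzMap.derivCLM ℝ ℂ f x = (deriv φ x : ℝ) := by
    intro x
    rw [SchwartzMap.derivCLM_apply]
    exact hgd x
  have hF : ∀ v, 𝓕 (SchwartzMap.derivCLM ℝ ℂ f) v = (2 * Real.pi * Complex.I * v) * 𝓕 f v := by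
    intro v
    rw [SchwartzMap.fourier_coe, SchwartzMap.fourier_coe]
    have h0 : (⇑(SchwartzMap.derivCLM ℝ ℂ f) : ℝ → ℂ) = deriv f := by
      ext x; exact SchwartzMap.derivCLM_apply ℝ f x
    have := Real.fourier_deriv (f := ⇑f) f.integrable f.differentiable
      (by rw [← h0]; exact (SchwartzMap.derivCLM ℝ ℂ f).integrable)
    rw [h0, this]; simp
  have hpi : (2 * Real.pi : ℝ)⁻¹ ≠ 0 := by positivity
  have hpi' : (Real.pi : ℂ) ≠ 0 := by exact_mod_cast Real.pi_ne_zero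
  have key : ∀ ξ : ℝ, Complex.I * ξ * ((2 * Real.pi)⁻¹ * 𝓕 f ((2 * Real.pi)⁻¹ * ξ)) =
      (2 * Real.pi)⁻¹ * 𝓕 (SchwartzMap.derivCLM ℝ ℂ f) ((2 * Real.pi)⁻¹ * ξ) := by
    intro ξ
    rw [hF]
    push_cast
    field_simp
  refine ⟨fun ξ => (2 * Real.pi)⁻¹ * 𝓕 f ((2 * Real.pi)⁻¹ * ξ), ?_, ?_, ?_, ?_⟩
  · exact ((𝓕 f).integrable.comp_mul_left' hpi).const_mul _
  · simp_rw [key]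
    exact ((𝓕 (SchwartzMap.derivCLM ℝ ℂ f)).integrable.comp_mul_left' hpi).const_mul _
  · intro x
    rw [← hf, f.eq_integral_fourier_scaled]
  · intro x
    simp_rw [key]
    rw [← hfd, SchwartzMap.eq_integral_fourier_scaled]

/-! ### Smooth cutoffs of half-open intervals -/

lemma exists_bound_deriv_smoothTransition :
    ∃ C : ℝ, 0 < C ∧ ∀ x, |deriv Real.smoothTransition x| ≤ (Set.Icc (0:ℝ) 1).indicator (fun _ => C) x := by
  have hcont : Continuous (deriv Real.smoothTransition) :=
    (Real.smoothTransition.contDiff (n := 1)).continuous_deriv le_rfl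
  obtain ⟨C, hC⟩ := (isCompact_Icc (a := (0:ℝ)) (b := 1)).exists_bound_of_continuousOn
    hcont.continuousOn
  refine ⟨max C 1, by positivity, fun x => ?_⟩
  by_cases hx : x ∈ Set.Icc (0:ℝ) 1
  · rw [Set.indicator_of_mem hx]
    exact (hC x hx).trans (le_max_left _ _)
  · rw [Set.indicator_of_notMem hx]
    have : deriv Real.smoothTransition x = 0 := by
      rw [Set.mem_Icc, not_and_or, not_le, not_le] at hx
      rcases hx with hx | hx
      · have : Real.smoothTransition =ᶠ[𝓝 x] fun _ => 0 := by
          filter_upwards [Iio_mem_nhds hx] with y hy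
          exact Real.smoothTransition.zero_of_nonpos (le_of_lt hy)
        rw [this.deriv_eq]; simp
      · have : Real.smoothTransition =ᶠ[𝓝 x] fun _ => 1 := by
          filter_upwards [Ioi_mem_nhds hx] with y hy
          exact Real.smoothTransition.one_of_one_le (le_of_lt hy)
        rw [this.deriv_eq]; simp
    simp [this]

/-- A smooth approximation, on the scale `ε`, of the indicator of `(a, b]`. -/
noncomputable def smoothCutoff (a b ε x : ℝ) : ℝ :=
  Real.smoothTransition ((b + ε - x) / ε) * Real.smoothTransition ((x - a) / ε)

lemma smoothCutoff_nonneg (a b ε x : ℝ) : 0 ≤ smoothCutoff a b ε x :=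
  mul_nonneg (Real.smoothTransition.nonneg _) (Real.smoothTransition.nonneg _)

lemma smoothCutoff_le_one (a b ε x : ℝ) : smoothCutoff a b ε x ≤ 1 :=
  mul_le_one₀ (Real.smoothTransition.le_one _) (Real.smoothTransition.nonneg _)
    (Real.smoothTransition.le_one _)

lemma contDiff_smoothCutoff (a b ε : ℝ) : ContDiff ℝ (⊤ : ℕ∞) (smoothCutoff a b ε) := by
  unfold smoothCutoff
  exact (Real.smoothTransition.contDiff.comp (by fun_prop)).mul
    (Real.smoothTransition.contDiff.comp (by fun_prop))

lemma hasCompactSupport_smoothCutoff (a b : ℝ) {ε : ℝ} (hε : 0 < ε) :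
    HasCompactSupport (smoothCutoff a b ε) := by
  refine HasCompactSupport.intro (isCompact_Icc (a := a) (b := b + ε)) fun x hx => ?_
  rw [Set.mem_Icc, not_and_or, not_le, not_le] at hx
  unfold smoothCutoff
  rcases hx with hx | hx
  · rw [Real.smoothTransition.zero_of_nonpos (x := (x - a) / ε), mul_zero]
    exact div_nonpos_of_nonpos_of_nonneg (by linarith) hε.le
  · rw [Real.smoothTransition.zero_of_nonpos (x := (b + ε - x) / ε), zero_mul]
    exact div_nonpos_of_nonpos_of_nonneg (by linarith) hε.le

/-- Both ramps lie to the right of their end-point, over `[a, a + ε]` and `[b, b + ε]`. At each `x`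
the value is therefore eventually constant, and the limit is exactly the indicator of the half-open
interval. -/
lemma tendsto_smoothCutoff (a b x : ℝ) {ι : Type*} {l : Filter ι} {ε : ι → ℝ}
    (hε : Tendsto ε l (𝓝[>] 0)) :
    Tendsto (fun i => smoothCutoff a b (ε i) x) l (𝓝 ((Set.Ioc a b).indicator (fun _ => 1) x)) := by
  have hpos : ∀ᶠ i in l, 0 < ε i := hε.eventually self_mem_nhdsWithin
  have h0 : Tendsto ε l (𝓝 0) := hε.mono_right nhdsWithin_le_nhds
  refine tendsto_const_nhds.congr' ?_
  unfold smoothCutoff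
  by_cases hxa : x ≤ a
  · filter_upwards [hpos] with i hi
    rw [Real.smoothTransition.zero_of_nonpos (x := (x - a) / ε i), mul_zero,
      Set.indicator_of_notMem (by simp [hxa])]
    exact div_nonpos_of_nonpos_of_nonneg (by linarith) hi.le
  · push Not at hxa
    by_cases hxb : x ≤ b
    · filter_upwards [hpos, h0.eventually_lt_const (sub_pos.2 hxa)] with i hi hi2
      rw [Set.indicator_of_mem (Set.mem_Ioc.2 ⟨hxa, hxb⟩), Real.smoothTransition.one_of_one_le,
        Real.smoothTransition.one_of_one_le, mul_one]
      · rw [le_div_iff₀ hi]; linarith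
      · rw [le_div_iff₀ hi]; linarith
    · push Not at hxb
      filter_upwards [hpos, h0.eventually_lt_const (sub_pos.2 hxb)] with i hi hi2
      rw [Real.smoothTransition.zero_of_nonpos (x := (b + ε i - x) / ε i), zero_mul,
        Set.indicator_of_notMem (by simp [hxb])]
      exact div_nonpos_of_nonpos_of_nonneg (by linarith) hi.le

/-- Each ramp contributes a bump of height `C / ε` and width `ε`, the other factor being at most
`1`. The `L¹` norm is thus at most `2C` for every `ε`, which allows `ε → 0` in the comparison. -/
lemma abs_deriv_smoothCutoff_le {C : ℝ}
    (hC : ∀ x, |deriv Real.smoothTransition x| ≤ (Set.Icc (0:ℝ) 1).indicator (fun _ => C) x)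
    (a b : ℝ) {ε : ℝ} (hε : 0 < ε) (x : ℝ) :
    |deriv (smoothCutoff a b ε) x| ≤
      (Set.Icc b (b + ε)).indicator (fun _ => C / ε) x +
      (Set.Icc a (a + ε)).indicator (fun _ => C / ε) x := by
  have hS : ∀ y, HasDerivAt Real.smoothTransition (deriv Real.smoothTransition y) y := fun y =>
    ((Real.smoothTransition.contDiff (n := 1)).differentiable (by simp) y).hasDerivAt
  have h1 : HasDerivAt (fun x => Real.smoothTransition ((b + ε - x) / ε))
      (deriv Real.smoothTransition ((b + ε - x) / ε) * (-1 / ε)) x :=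
    (hS _).comp x (((hasDerivAt_id x).const_sub (b + ε)).div_const ε)
  have h2 : HasDerivAt (fun x => Real.smoothTransition ((x - a) / ε))
      (deriv Real.smoothTransition ((x - a) / ε) * (1 / ε)) x :=
    (hS _).comp x (((hasDerivAt_id x).sub_const a).div_const ε)
  have h3 := (h1.mul h2).deriv
  have h4 : deriv (smoothCutoff a b ε) x = _ := h3
  rw [h4]
  refine (abs_add_le _ _).trans ?_
  have habs : ∀ y, |Real.smoothTransition y| ≤ 1 := fun y => by
    rw [abs_of_nonneg (Real.smoothTransition.nonneg y)]; exact Real.smoothTransition.le_one y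
  have e1 : |(-1 / ε)| = 1 / ε := by rw [abs_div, abs_of_pos hε]; simp
  have e2 : |(1 / ε)| = 1 / ε := abs_of_pos (by positivity)
  have i1 : |deriv Real.smoothTransition ((b + ε - x) / ε)| * (1 / ε) ≤
      (Set.Icc b (b + ε)).indicator (fun _ => C / ε) x := by
    refine (mul_le_mul_of_nonneg_right (hC _) (by positivity)).trans (le_of_eq ?_)
    have : (b + ε - x) / ε ∈ Set.Icc (0:ℝ) 1 ↔ x ∈ Set.Icc b (b + ε) := by
      rw [Set.mem_Icc, Set.mem_Icc, div_le_one hε, le_div_iff₀ hε, zero_mul]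
      constructor <;> rintro ⟨h, h'⟩ <;> constructor <;> linarith
    by_cases hx : x ∈ Set.Icc b (b + ε)
    · rw [Set.indicator_of_mem hx, Set.indicator_of_mem (this.2 hx)]; ring
    · rw [Set.indicator_of_notMem hx, Set.indicator_of_notMem (fun h => hx (this.1 h))]; ring
  have i2 : |deriv Real.smoothTransition ((x - a) / ε)| * (1 / ε) ≤
      (Set.Icc a (a + ε)).indicator (fun _ => C / ε) x := by
    refine (mul_le_mul_of_nonneg_right (hC _) (by positivity)).trans (le_of_eq ?_)
    have : (x - a) / ε ∈ Set.Icc (0:ℝ) 1 ↔ x ∈ Set.Icc a (a + ε) := by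
      rw [Set.mem_Icc, Set.mem_Icc, div_le_one hε, le_div_iff₀ hε, zero_mul]
      constructor <;> rintro ⟨h, h'⟩ <;> constructor <;> linarith
    by_cases hx : x ∈ Set.Icc a (a + ε)
    · rw [Set.indicator_of_mem hx, Set.indicator_of_mem (this.2 hx)]; ring
    · rw [Set.indicator_of_notMem hx, Set.indicator_of_notMem (fun h => hx (this.1 h))]; ring
  refine add_le_add ?_ ?_
  · rw [abs_mul, abs_mul, e1]
    exact (mul_le_of_le_one_right (by positivity) (habs _)).trans i1
  · rw [abs_mul, abs_mul, e2]
    exact (mul_le_of_le_one_left (by positivity) (habs _)).trans i2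

/-! ### Gaussian interpolation on the Fourier side -/

section Interpolation
variable {ι : Type*} [Fintype ι]

/-- The quadratic form with matrix `Λ`. -/
def quadForm (Λ : ι → ι → ℝ) (ξ : ι → ℝ) : ℝ := ∑ i, ∑ j, Λ i j * ξ i * ξ j

/-- `μ` has the characteristic function of the centred Gaussian law with covariance matrix `Λ`. -/
def IsCenteredGaussian (μ : Measure (ι → ℝ)) (Λ : ι → ι → ℝ) : Prop :=
  ∀ ξ : ι → ℝ, ∫ x, Complex.exp (Complex.I * ((∑ j, ξ j * x j : ℝ) : ℂ)) ∂μ =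
    (Real.exp (-quadForm Λ ξ / 2) : ℂ)

@[fun_prop]
lemma continuous_quadForm (Λ : ι → ι → ℝ) : Continuous (quadForm Λ) := by
  unfold quadForm; fun_prop

lemma quadForm_combination (Λ₁ Λ₀ : ι → ι → ℝ) (t : ℝ) (ξ : ι → ℝ) :
    quadForm (fun i j => t * Λ₁ i j + (1 - t) * Λ₀ i j) ξ =
      t * quadForm Λ₁ ξ + (1 - t) * quadForm Λ₀ ξ := by
  simp only [quadForm, Finset.mul_sum, ← Finset.sum_add_distrib]
  refine Finset.sum_congr rfl fun i _ => Finset.sum_congr rfl fun j _ => by ring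

lemma norm_exp_I_mul (x : ℝ) : ‖Complex.exp (Complex.I * (x : ℂ))‖ = 1 := by
  rw [mul_comm]; exact Complex.norm_exp_ofReal_mul_I x

/-- A characteristic function has modulus at most `1`; this replaces any discussion of positive
semidefinite matrices. -/
lemma IsCenteredGaussian.exp_quadForm_le_one {μ : Measure (ι → ℝ)} [IsProbabilityMeasure μ]
    {Λ : ι → ι → ℝ} (h : IsCenteredGaussian μ Λ) (ξ : ι → ℝ) :
    Real.exp (-quadForm Λ ξ / 2) ≤ 1 := by
  have h1 := norm_integral_le_of_norm_le_const (μ := μ)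
    (f := fun x => Complex.exp (Complex.I * ((∑ j, ξ j * x j : ℝ) : ℂ)))
    (ae_of_all _ fun x => (norm_exp_I_mul _).le)
  rw [h ξ, Complex.norm_real, Real.norm_of_nonneg (Real.exp_pos _).le] at h1
  simpa using h1

lemma quadForm_smul (Λ : ι → ι → ℝ) (c : ℝ) (ξ : ι → ℝ) :
    quadForm Λ (fun j => c * ξ j) = c ^ 2 * quadForm Λ ξ := by
  simp only [quadForm, Finset.mul_sum]
  refine Finset.sum_congr rfl fun i _ => Finset.sum_congr rfl fun j _ => by ring

lemma IsCenteredGaussian.integral_exp_smul {μ : Measure (ι → ℝ)} {Λ : ι → ι → ℝ}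
    (h : IsCenteredGaussian μ Λ) (c : ℝ) (ξ : ι → ℝ) :
    ∫ x, Complex.exp (Complex.I * ((∑ j, ξ j * (c * x j) : ℝ) : ℂ)) ∂μ =
      (Real.exp (-(c ^ 2 * quadForm Λ ξ) / 2) : ℂ) := by
  rw [← quadForm_smul, ← h]
  refine integral_congr_ae (ae_of_all _ fun x => ?_)
  simp only
  congr 4
  ext j; ring

/-- The law of `√t X + √(1 - t) Y` for independent `X ∼ μ₁`, `Y ∼ μ₀`. -/
noncomputable def interpLaw (μ₁ μ₀ : Measure (ι → ℝ)) (t : ℝ) : Measure (ι → ℝ) :=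
  (μ₁.prod μ₀).map fun p j => √t * p.1 j + √(1 - t) * p.2 j

lemma measurable_interp {κ : Type*} (t : ℝ) :
    Measurable fun (p : (κ → ℝ) × (κ → ℝ)) (j : κ) => √t * p.1 j + √(1 - t) * p.2 j := by
  fun_prop

instance (μ₁ μ₀ : Measure (ι → ℝ)) [IsProbabilityMeasure μ₁] [IsProbabilityMeasure μ₀] (t : ℝ) :
    IsProbabilityMeasure (interpLaw μ₁ μ₀ t) :=
  Measure.isProbabilityMeasure_map (measurable_interp t).aemeasurable

/-- Independence factorises the characteristic function, and the squared weights are `t` and `1 -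
t`. Every matrix on the segment is thus the covariance of an actual law, under which expectations
can be bounded. -/
lemma IsCenteredGaussian.interpLaw {μ₁ μ₀ : Measure (ι → ℝ)} [IsProbabilityMeasure μ₁]
    [IsProbabilityMeasure μ₀] {Λ₁ Λ₀ : ι → ι → ℝ} (h₁ : IsCenteredGaussian μ₁ Λ₁)
    (h₀ : IsCenteredGaussian μ₀ Λ₀) {t : ℝ} (ht : t ∈ Set.Icc (0 : ℝ) 1) :
    IsCenteredGaussian (interpLaw μ₁ μ₀ t) (fun i j => t * Λ₁ i j + (1 - t) * Λ₀ i j) := by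
  intro ξ
  rw [_root_.interpLaw, integral_map (measurable_interp t).aemeasurable
    (Continuous.aestronglyMeasurable (by fun_prop))]
  have : ∀ p : (ι → ℝ) × (ι → ℝ),
      Complex.exp (Complex.I * ((∑ j, ξ j * (√t * p.1 j + √(1 - t) * p.2 j) : ℝ) : ℂ)) =
      Complex.exp (Complex.I * ((∑ j, ξ j * (√t * p.1 j) : ℝ) : ℂ)) *
      Complex.exp (Complex.I * ((∑ j, ξ j * (√(1 - t) * p.2 j) : ℝ) : ℂ)) := by
    intro p
    rw [← Complex.exp_add, ← mul_add, ← Complex.ofReal_add, ← Finset.sum_add_distrib]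
    simp only [mul_add]
  simp_rw [this]
  rw [integral_prod_mul (fun x : ι → ℝ => Complex.exp (Complex.I * ((∑ j, ξ j * (√t * x j) : ℝ) : ℂ)))
    (fun x : ι → ℝ => Complex.exp (Complex.I * ((∑ j, ξ j * (√(1 - t) * x j) : ℝ) : ℂ))),
    h₁.integral_exp_smul, h₀.integral_exp_smul, quadForm_combination, Real.sq_sqrt ht.1,
    Real.sq_sqrt (sub_nonneg.2 ht.2), ← Complex.ofReal_mul, ← Real.exp_add]
  congr 2; ring

lemma integrable_prod_fourier {ψ : ι → ℝ → ℂ} (hψ : ∀ j, Integrable (ψ j)) :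
    Integrable fun ξ : ι → ℝ => ∏ j, ψ j (ξ j) :=
  Integrable.fintype_prod hψ

/-- Parseval's formula for product functions and Gaussian laws. -/
lemma IsCenteredGaussian.integral_prod_eq {μ : Measure (ι → ℝ)} [IsProbabilityMeasure μ]
    {Λ : ι → ι → ℝ} (h : IsCenteredGaussian μ Λ) {f : ι → ℝ → ℝ} {ψ : ι → ℝ → ℂ}
    (hψ : ∀ j, Integrable (ψ j))
    (hf : ∀ j x, (f j x : ℂ) = ∫ ξ : ℝ, ψ j ξ * Complex.exp (Complex.I * (ξ * x : ℝ))) :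
    ((∫ x, ∏ j, f j (x j) ∂μ : ℝ) : ℂ) =
      ∫ ξ : ι → ℝ, (∏ j, ψ j (ξ j)) * (Real.exp (-quadForm Λ ξ / 2) : ℂ) := by
  have h1 : ∀ x : ι → ℝ, ((∏ j, f j (x j) : ℝ) : ℂ) =
      ∫ ξ : ι → ℝ, (∏ j, ψ j (ξ j)) * Complex.exp (Complex.I * ((∑ j, ξ j * x j : ℝ) : ℂ)) := by
    intro x
    rw [Complex.ofReal_prod]
    simp_rw [hf]
    rw [← integral_fintype_prod_volume_eq_prod
      (fun j (ξ : ℝ) => ψ j ξ * Complex.exp (Complex.I * (ξ * x j : ℝ)))]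
    refine integral_congr_ae (ae_of_all _ fun ξ => ?_)
    simp only
    rw [Finset.prod_mul_distrib, ← Complex.exp_sum, ← Finset.mul_sum, Complex.ofReal_sum]
  rw [← integral_complex_ofReal]
  simp_rw [h1]
  rw [integral_integral_swap]
  · refine integral_congr_ae (ae_of_all _ fun ξ => ?_)
    simp only
    rw [integral_const_mul, h ξ]
  · have hi : Integrable (fun p : (ι → ℝ) × (ι → ℝ) => ∏ j, ψ j (p.2 j)) (μ.prod volume) :=
      (integrable_prod_fourier hψ).comp_snd μ
    have hg : AEStronglyMeasurable (fun p : (ι → ℝ) × (ι → ℝ) =>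
        Complex.exp (Complex.I * ((∑ j, p.2 j * p.1 j : ℝ) : ℂ))) (μ.prod volume) :=
      Continuous.aestronglyMeasurable (by fun_prop)
    exact hi.mul_bdd (c := 1) hg (ae_of_all _ fun p => (norm_exp_I_mul _).le)

/-- Gaussian interpolation for products of functions of one variable. -/
lemma abs_integral_prod_sub_le [DecidableEq ι] {μ₁ μ₀ : Measure (ι → ℝ)} [IsProbabilityMeasure μ₁]
    [IsProbabilityMeasure μ₀] {Λ₁ Λ₀ : ι → ι → ℝ} (h₁ : IsCenteredGaussian μ₁ Λ₁)
    (h₀ : IsCenteredGaussian μ₀ Λ₀) (hdiag : ∀ i, Λ₁ i i = Λ₀ i i)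
    {f f' : ι → ℝ → ℝ} {ψ : ι → ℝ → ℂ} (hf : ∀ j, HasFourierRep (f j) (f' j) (ψ j))
    (hf1 : ∀ j x, |f j x| ≤ 1) {B : ι → ι → ℝ}
    (hB : ∀ i j, i ≠ j → Λ₁ i j ≠ Λ₀ i j → ∀ t ∈ Set.Icc (0 : ℝ) 1,
      Integrable (fun x : ι → ℝ => |f' i (x i)| * |f' j (x j)|) (interpLaw μ₁ μ₀ t) ∧
      ∫ x, |f' i (x i)| * |f' j (x j)| ∂(interpLaw μ₁ μ₀ t) ≤ B i j) :
    |∫ x, ∏ j, f j (x j) ∂μ₁ - ∫ x, ∏ j, f j (x j) ∂μ₀| ≤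
      (1 / 2) * ∑ i, ∑ j, |Λ₁ i j - Λ₀ i j| * B i j := by
  set D : (ι → ℝ) → ℝ := fun ξ => quadForm Λ₁ ξ - quadForm Λ₀ ξ with hD
  set Q : ℝ → (ι → ℝ) → ℝ :=
    fun t ξ => quadForm (fun i j => t * Λ₁ i j + (1 - t) * Λ₀ i j) ξ with hQ
  have hQeq : ∀ t ξ, Q t ξ = quadForm Λ₀ ξ + t * D ξ := fun t ξ => by
    simp only [hQ, hD, quadForm_combination]; ring
  -- the modified factors
  set ψ' : ι → ι → ι → ℝ → ℂ :=
    fun i j k ξ => if k = i ∨ k = j then Complex.I * ξ * ψ k ξ else ψ k ξ with hψ'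
  set g : ι → ι → ι → ℝ → ℝ := fun i j k x => if k = i ∨ k = j then f' k x else f k x with hg
  have hψ'int : ∀ i j k, Integrable (ψ' i j k) := by
    intro i j k
    simp only [hψ']
    split_ifs
    · exact (hf k).integrable_mul
    · exact (hf k).integrable
  have hgrep : ∀ i j k x, (g i j k x : ℂ) =
      ∫ ξ : ℝ, ψ' i j k ξ * Complex.exp (Complex.I * (ξ * x : ℝ)) := by
    intro i j k x
    simp only [hψ', hg]
    split_ifs
    · exact (hf k).deriv_eq_integral x
    · exact (hf k).eq_integral x
  -- Differentiation in the coordinates `i` and `j` multiplies the transform by `(iξ_i)(iξ_j) = -ξ_i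
  -- ξ_j`. Diagonal terms will cancel by `hdiag`, so no factor is ever differentiated twice.
  have hprodψ : ∀ i j, i ≠ j → ∀ ξ : ι → ℝ,
      ∏ k, ψ' i j k (ξ k) = -(ξ i * ξ j : ℝ) * ∏ k, ψ k (ξ k) := by
    intro i j hij ξ
    have : ∀ k, ψ' i j k (ξ k) =
        (if k = i ∨ k = j then Complex.I * ξ k else 1) * ψ k (ξ k) := by
      intro k; simp only [hψ']; split_ifs <;> ring
    simp_rw [this]
    rw [Finset.prod_mul_distrib]
    congr 1
    rw [Finset.prod_ite, Finset.prod_const_one, mul_one]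
    have hfil : (Finset.univ.filter fun k => k = i ∨ k = j) = {i, j} := by
      ext k; simp
    rw [hfil, Finset.prod_pair hij]
    push_cast
    linear_combination (ξ i : ℂ) * ξ j * Complex.I_mul_I
  have hprodg : ∀ i j, i ≠ j → ∀ x : ι → ℝ,
      |∏ k, g i j k (x k)| ≤ |f' i (x i)| * |f' j (x j)| := by
    intro i j hij x
    rw [Finset.abs_prod]
    have : ∀ k, |g i j k (x k)| ≤ (if k = i ∨ k = j then |f' k (x k)| else 1) := by
      intro k; simp only [hg]; split_ifs
      · rfl
      · exact hf1 _ _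
    refine (Finset.prod_le_prod (fun k _ => abs_nonneg _) fun k _ => this k).trans ?_
    rw [Finset.prod_ite, Finset.prod_const_one, mul_one]
    have hfil : (Finset.univ.filter fun k => k = i ∨ k = j) = {i, j} := by
      ext k; simp
    rw [hfil, Finset.prod_pair hij]
  -- integrated derivative
  have hnn : ∀ t ∈ Set.Icc (0:ℝ) 1, ∀ ξ, Real.exp (-Q t ξ / 2) ≤ 1 := fun t ht ξ =>
    (h₁.interpLaw h₀ ht).exp_quadForm_le_one ξ
  have hDsum : ∀ ξ : ι → ℝ, D ξ = ∑ i, ∑ j, (Λ₁ i j - Λ₀ i j) * ξ i * ξ j := by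
    intro ξ
    simp only [hD, quadForm, ← Finset.sum_sub_distrib]
    refine Finset.sum_congr rfl fun i _ => Finset.sum_congr rfl fun j _ => by ring
  have hterm : ∀ ξ : ι → ℝ, (-(D ξ) / 2 : ℂ) * ∏ k, ψ k (ξ k) =
      ∑ i, ∑ j, ((Λ₁ i j - Λ₀ i j) / 2 : ℝ) * ∏ k, ψ' i j k (ξ k) := by
    intro ξ
    rw [hDsum]
    push_cast
    rw [neg_div, Finset.sum_div, ← Finset.sum_neg_distrib, Finset.sum_mul]
    refine Finset.sum_congr rfl fun i _ => ?_
    rw [Finset.sum_div, ← Finset.sum_neg_distrib, Finset.sum_mul]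
    refine Finset.sum_congr rfl fun j _ => ?_
    by_cases hij : i = j
    · subst hij; rw [hdiag]; simp
    · rw [hprodψ i j hij]; push_cast; ring
  have hint : Integrable fun ξ : ι → ℝ => (-(D ξ) / 2 : ℂ) * ∏ k, ψ k (ξ k) := by
    simp_rw [hterm]
    exact integrable_finsetSum _ fun i _ => integrable_finsetSum _ fun j _ =>
      (integrable_prod_fourier (hψ'int i j)).const_mul _
  -- The derivative along the segment, from `∂ₜ exp (-Q t / 2) = -(D / 2) exp (-Q t / 2)`. Read back
  -- through Parseval's formula it equals `½ ∑ (Λ₁ - Λ₀) i j` times expectations of the products of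
  -- `g i j k`.
  set V : ℝ → ℂ := fun t => ∫ ξ : ι → ℝ,
    ((-(D ξ) / 2 : ℂ) * ∏ k, ψ k (ξ k)) * (Real.exp (-Q t ξ / 2) : ℂ) with hV
  have hVbound : ∀ t ∈ Set.Icc (0:ℝ) 1,
      ‖V t‖ ≤ (1 / 2) * ∑ i, ∑ j, |Λ₁ i j - Λ₀ i j| * B i j := by
    intro t ht
    have hcg := h₁.interpLaw h₀ ht
    have e1 : V t = ∑ i, ∑ j, ((Λ₁ i j - Λ₀ i j) / 2 : ℝ) *
        ((∫ x, ∏ k, g i j k (x k) ∂(interpLaw μ₁ μ₀ t) : ℝ) : ℂ) := by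
      have hbd : ∀ i j, Integrable fun ξ : ι → ℝ =>
          (∏ k, ψ' i j k (ξ k)) * (Real.exp (-Q t ξ / 2) : ℂ) := by
        intro i j
        refine (integrable_prod_fourier (hψ'int i j)).mul_bdd (c := 1) ?_ (ae_of_all _ fun ξ => ?_)
        · exact Continuous.aestronglyMeasurable (by simp only [hQ]; fun_prop)
        · rw [Complex.norm_real, Real.norm_of_nonneg (Real.exp_pos _).le]; exact hnn t ht ξ
      simp only [hV]
      simp_rw [hterm, Finset.sum_mul, mul_assoc]
      rw [integral_finsetSum _ fun i _ => integrable_finsetSum _ fun j _ =>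
        (hbd i j).const_mul _]
      refine Finset.sum_congr rfl fun i _ => ?_
      rw [integral_finsetSum _ fun j _ => (hbd i j).const_mul _]
      refine Finset.sum_congr rfl fun j _ => ?_
      rw [integral_const_mul, hcg.integral_prod_eq (hψ'int i j) (hgrep i j)]
    rw [e1, Finset.mul_sum]
    refine (norm_sum_le _ _).trans (Finset.sum_le_sum fun i _ => ?_)
    rw [Finset.mul_sum]
    refine (norm_sum_le _ _).trans (Finset.sum_le_sum fun j _ => ?_)
    by_cases hij : i = j
    · subst hij; simp [hdiag]
    by_cases hΛ : Λ₁ i j = Λ₀ i j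
    · simp [hΛ]
    obtain ⟨hi, hle⟩ := hB i j hij hΛ t ht
    rw [norm_mul, Complex.norm_real, Complex.norm_real, Real.norm_eq_abs, Real.norm_eq_abs,
      abs_div, abs_two]
    have : |∫ x, ∏ k, g i j k (x k) ∂(interpLaw μ₁ μ₀ t)| ≤ B i j := by
      refine (abs_integral_le_integral_abs).trans (le_trans ?_ hle)
      exact integral_mono_of_nonneg (ae_of_all _ fun x => abs_nonneg _) hi
        (ae_of_all _ fun x => hprodg i j hij x)
    calc _ ≤ |Λ₁ i j - Λ₀ i j| / 2 * B i j := by gcongr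
      _ = _ := by ring
  have hmain : ((∫ x, ∏ j, f j (x j) ∂μ₁ : ℝ) : ℂ) - ((∫ x, ∏ j, f j (x j) ∂μ₀ : ℝ) : ℂ) =
      ∫ t in (0:ℝ)..1, V t := by
    rw [h₁.integral_prod_eq (fun j => (hf j).integrable) (fun j => (hf j).eq_integral),
      h₀.integral_prod_eq (fun j => (hf j).integrable) (fun j => (hf j).eq_integral)]
    have hbd : ∀ {Λ : ι → ι → ℝ} {μ : Measure (ι → ℝ)} [IsProbabilityMeasure μ],
        IsCenteredGaussian μ Λ → Integrable fun ξ : ι → ℝ =>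
          (∏ k, ψ k (ξ k)) * (Real.exp (-quadForm Λ ξ / 2) : ℂ) := by
      intro Λ μ _ hμ
      refine (integrable_prod_fourier fun j => (hf j).integrable).mul_bdd (c := 1) ?_
        (ae_of_all _ fun ξ => ?_)
      · exact Continuous.aestronglyMeasurable (by fun_prop)
      · rw [Complex.norm_real, Real.norm_of_nonneg (Real.exp_pos _).le]
        exact hμ.exp_quadForm_le_one ξ
    rw [← integral_sub (hbd h₁) (hbd h₀)]
    have hft : ∀ ξ : ι → ℝ, (∏ k, ψ k (ξ k)) * (Real.exp (-quadForm Λ₁ ξ / 2) : ℂ) -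
        (∏ k, ψ k (ξ k)) * (Real.exp (-quadForm Λ₀ ξ / 2) : ℂ) =
        ∫ t in (0:ℝ)..1, ((-(D ξ) / 2 : ℂ) * ∏ k, ψ k (ξ k)) * (Real.exp (-Q t ξ / 2) : ℂ) := by
      intro ξ
      have hder : ∀ t ∈ Set.uIcc (0:ℝ) 1, HasDerivAt (fun t : ℝ => Real.exp (-Q t ξ / 2))
          (Real.exp (-Q t ξ / 2) * (-(D ξ) / 2)) t := by
        intro t _
        simp_rw [hQeq]
        refine HasDerivAt.exp ?_
        have := ((((hasDerivAt_id t).mul_const (D ξ)).const_add (quadForm Λ₀ ξ)).neg).div_const 2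
        simpa using this
      have hcont : Continuous fun t : ℝ => Real.exp (-Q t ξ / 2) * (-(D ξ) / 2) := by
        simp_rw [hQeq]; fun_prop
      have := intervalIntegral.integral_eq_sub_of_hasDerivAt hder
        (hcont.intervalIntegrable _ _)
      have hq1 : Q 1 ξ = quadForm Λ₁ ξ := by rw [hQeq]; simp [hD]
      have hq0 : Q 0 ξ = quadForm Λ₀ ξ := by rw [hQeq]; simp
      rw [hq1, hq0] at this
      rw [← mul_sub, ← Complex.ofReal_sub, ← this, ← intervalIntegral.integral_ofReal,
        ← intervalIntegral.integral_const_mul]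
      refine intervalIntegral.integral_congr fun t _ => ?_
      push_cast; ring
    simp_rw [hft]
    rw [intervalIntegral_integral_swap]
    have : IsFiniteMeasure (volume.restrict (Set.uIoc (0:ℝ) 1)) :=
      ⟨by rw [Set.uIoc_of_le zero_le_one]; simp⟩
    have hi : Integrable (fun p : ℝ × (ι → ℝ) => (-(D p.2) / 2 : ℂ) * ∏ k, ψ k (p.2 k))
        ((volume.restrict (Set.uIoc (0:ℝ) 1)).prod volume) := hint.comp_snd _
    have hg : AEStronglyMeasurable (fun p : ℝ × (ι → ℝ) => (Real.exp (-Q p.1 p.2 / 2) : ℂ))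
        ((volume.restrict (Set.uIoc (0:ℝ) 1)).prod volume) := by
      refine Continuous.aestronglyMeasurable ?_
      simp_rw [hQeq, hD]
      fun_prop
    refine hi.mul_bdd (c := 1) hg ?_
    have hae : ∀ᵐ p ∂((volume.restrict (Set.uIoc (0:ℝ) 1)).prod (volume : Measure (ι → ℝ))),
        p.1 ∈ Set.uIoc (0:ℝ) 1 :=
      Measure.quasiMeasurePreserving_fst.ae (ae_restrict_mem measurableSet_uIoc)
    filter_upwards [hae] with p hp
    rw [Set.uIoc_of_le zero_le_one] at hp
    rw [Complex.norm_real, Real.norm_of_nonneg (Real.exp_pos _).le]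
    exact hnn _ ⟨hp.1.le, hp.2⟩ _
  rw [← Complex.ofReal_sub] at hmain
  rw [← Real.norm_eq_abs, ← Complex.norm_real, hmain]
  refine (intervalIntegral.norm_integral_le_of_norm_le_const
    (C := (1 / 2) * ∑ i, ∑ j, |Λ₁ i j - Λ₀ i j| * B i j) fun t ht => ?_).trans (by simp)
  rw [Set.uIoc_of_le zero_le_one] at ht
  exact hVbound t ⟨ht.1.le, ht.2⟩

end Interpolation

/-! ### The bivariate normal law and its density bound -/

/-- The bivariate centred Gaussian law with unit variances and correlation `r`. -/
noncomputable def bivLaw (r : ℝ) : Measure (ℝ × ℝ) :=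
  ((gaussianReal 0 1).prod (gaussianReal 0 1)).map
    fun p => (p.1, r * p.1 + √(1 - r ^ 2) * p.2)

lemma measurable_bivMap (r : ℝ) :
    Measurable fun p : ℝ × ℝ => (p.1, r * p.1 + √(1 - r ^ 2) * p.2) := by fun_prop

instance (r : ℝ) : IsProbabilityMeasure (bivLaw r) :=
  Measure.isProbabilityMeasure_map (measurable_bivMap r).aemeasurable

lemma integral_exp_gaussianReal (t : ℝ) :
    ∫ x, Complex.exp (Complex.I * ((t * x : ℝ) : ℂ)) ∂(gaussianReal 0 1) =
      (Real.exp (-t ^ 2 / 2) : ℂ) := by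
  have h := charFun_gaussianReal (μ := 0) (v := 1) t
  rw [charFun_apply_real] at h
  simp only [Complex.ofReal_zero, mul_zero, zero_mul, NNReal.coe_one, Complex.ofReal_one, one_mul,
    zero_sub] at h
  rw [Complex.ofReal_exp]
  push_cast
  rw [neg_div, ← h]
  refine integral_congr_ae (ae_of_all _ fun x => ?_)
  simp only
  congr 1; ring

lemma integral_exp_bivLaw {r : ℝ} (hr : |r| ≤ 1) (a b : ℝ) :
    ∫ p, Complex.exp (Complex.I * ((a * p.1 + b * p.2 : ℝ) : ℂ)) ∂(bivLaw r) =
      (Real.exp (-(a ^ 2 + 2 * r * a * b + b ^ 2) / 2) : ℂ) := by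
  rw [bivLaw, integral_map (measurable_bivMap r).aemeasurable
    (Continuous.aestronglyMeasurable (by fun_prop))]
  have : ∀ p : ℝ × ℝ,
      Complex.exp (Complex.I * ((a * p.1 + b * (r * p.1 + √(1 - r ^ 2) * p.2) : ℝ) : ℂ)) =
      Complex.exp (Complex.I * (((a + b * r) * p.1 : ℝ) : ℂ)) *
      Complex.exp (Complex.I * (((b * √(1 - r ^ 2)) * p.2 : ℝ) : ℂ)) := by
    intro p
    rw [← Complex.exp_add, ← mul_add, ← Complex.ofReal_add]
    congr 3; ring
  simp_rw [this]
  rw [integral_prod_mul (fun x : ℝ => Complex.exp (Complex.I * (((a + b * r) * x : ℝ) : ℂ)))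
    (fun x : ℝ => Complex.exp (Complex.I * (((b * √(1 - r ^ 2)) * x : ℝ) : ℂ))),
    integral_exp_gaussianReal, integral_exp_gaussianReal, ← Complex.ofReal_mul, ← Real.exp_add,
    mul_pow, Real.sq_sqrt]
  · congr 2; ring
  · have := (sq_le_one_iff_abs_le_one r).2 hr
    linarith

/-- Finite measures on the plane are determined by their characteristic functions. -/
lemma measure_prod_ext_of_integral_exp {μ ν : Measure (ℝ × ℝ)} [IsFiniteMeasure μ]
    [IsFiniteMeasure ν]
    (h : ∀ a b : ℝ, ∫ p, Complex.exp (Complex.I * ((a * p.1 + b * p.2 : ℝ) : ℂ)) ∂μ =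
      ∫ p, Complex.exp (Complex.I * ((a * p.1 + b * p.2 : ℝ) : ℂ)) ∂ν) : μ = ν := by
  refine Measure.ext_of_charFunDual (funext fun L => ?_)
  rw [charFunDual_apply, charFunDual_apply]
  have hL : ∀ p : ℝ × ℝ, L p = L (1, 0) * p.1 + L (0, 1) * p.2 := by
    intro p
    have : p = p.1 • ((1, 0) : ℝ × ℝ) + p.2 • ((0, 1) : ℝ × ℝ) := by ext <;> simp
    conv_lhs => rw [this]
    rw [map_add, map_smul, map_smul, smul_eq_mul, smul_eq_mul]; ring
  have := h (L (1, 0)) (L (0, 1))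
  simp_rw [← hL] at this
  simpa only [mul_comm Complex.I] using this

lemma bivLaw_map_swap {r : ℝ} (hr : |r| ≤ 1) : (bivLaw r).map Prod.swap = bivLaw r := by
  have : IsProbabilityMeasure ((bivLaw r).map Prod.swap) :=
    Measure.isProbabilityMeasure_map measurable_swap.aemeasurable
  refine measure_prod_ext_of_integral_exp fun a b => ?_
  rw [integral_map measurable_swap.aemeasurable (Continuous.aestronglyMeasurable (by fun_prop)),
    integral_exp_bivLaw hr]
  have := integral_exp_bivLaw hr b a
  simp only [Prod.fst_swap, Prod.snd_swap]
  rw [show -(a ^ 2 + 2 * r * a * b + b ^ 2) / 2 = -(b ^ 2 + 2 * r * b * a + a ^ 2) / 2 by ring,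
    ← this]
  simp_rw [add_comm]

lemma bivLaw_map_neg {r : ℝ} (hr : |r| ≤ 1) : (bivLaw r).map (fun p => -p) = bivLaw r := by
  have : IsProbabilityMeasure ((bivLaw r).map (fun p => -p)) :=
    Measure.isProbabilityMeasure_map measurable_neg.aemeasurable
  refine measure_prod_ext_of_integral_exp fun a b => ?_
  rw [integral_map measurable_neg.aemeasurable (Continuous.aestronglyMeasurable (by fun_prop)),
    integral_exp_bivLaw hr]
  have := integral_exp_bivLaw hr (-a) (-b)
  rw [show -(a ^ 2 + 2 * r * a * b + b ^ 2) / 2 =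
    -((-a) ^ 2 + 2 * r * (-a) * (-b) + (-b) ^ 2) / 2 by ring, ← this]
  simp

section
variable {ι : Type*} [Fintype ι]

/-- Test vectors supported on `{i, j}` already determine the law of the pair. -/
lemma IsCenteredGaussian.map_pair [DecidableEq ι] {μ : Measure (ι → ℝ)} [IsProbabilityMeasure μ]
    {Λ : ι → ι → ℝ} (h : IsCenteredGaussian μ Λ) {i j : ι} (hij : i ≠ j) (hi : Λ i i = 1)
    (hj : Λ j j = 1) (hsymm : Λ j i = Λ i j) (hle : |Λ i j| ≤ 1) :
    μ.map (fun x => (x i, x j)) = bivLaw (Λ i j) := by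
  have hm : Measurable fun x : ι → ℝ => (x i, x j) := by fun_prop
  have : IsProbabilityMeasure (μ.map fun x => (x i, x j)) :=
    Measure.isProbabilityMeasure_map hm.aemeasurable
  refine measure_prod_ext_of_integral_exp fun a b => ?_
  rw [integral_map hm.aemeasurable (Continuous.aestronglyMeasurable (by fun_prop)),
    integral_exp_bivLaw hle]
  have key : ∀ F : ι → ℝ, ∑ k, (if k = i then a else if k = j then b else 0) * F k =
      a * F i + b * F j := by
    intro F
    have : ∀ k, (if k = i then a else if k = j then b else 0) * F k =
        (if k = i then a * F k else 0) + (if k = j then b * F k else 0) := by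
      intro k
      by_cases h1 : k = i
      · subst h1; simp [hij]
      · simp [h1]
    simp_rw [this]
    rw [Finset.sum_add_distrib]; simp
  have := h fun k => if k = i then a else if k = j then b else 0
  simp_rw [key] at this
  rw [this]
  congr 3
  have e : ∀ k l, Λ k l * (if k = i then a else if k = j then b else 0) *
      (if l = i then a else if l = j then b else 0) =
      (if k = i then a else if k = j then b else 0) *
      ((if l = i then a else if l = j then b else 0) * Λ k l) := fun k l => by ring
  simp only [quadForm, e, ← Finset.mul_sum, key, hi, hj, hsymm]
  ring

/-- Where `|x|, |y| ≥ w` one has `x² - 2rxy + y² ≥ (1 - |r|)(x² + y²) ≥ 2(1 - |r|)w²`, and dividing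
by `2(1 - r²) = 2(1 - |r|)(1 + |r|)` leaves `w² / (1 + |r|)`. The joint density is used as the
product of a marginal and a conditional density. -/
lemma lintegral_bivLaw_le {r w : ℝ} (hr : |r| < 1) (hw : 0 ≤ w) {f g : ℝ → ℝ≥0∞}
    (hf : Measurable f) (hg : Measurable g) (hfw : ∀ x, |x| < w → f x = 0)
    (hgw : ∀ x, |x| < w → g x = 0) :
    ∫⁻ p, f p.1 * g p.2 ∂(bivLaw r) ≤
      ENNReal.ofReal ((2 * Real.pi * √(1 - r ^ 2))⁻¹ * Real.exp (-w ^ 2 / (1 + |r|))) *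
        ((∫⁻ x, f x) * ∫⁻ x, g x) := by
  have hr2 : 0 < 1 - r ^ 2 := by
    have := (sq_lt_one_iff_abs_lt_one r).2 hr
    linarith
  set s : ℝ := √(1 - r ^ 2) with hs
  have hspos : 0 < s := Real.sqrt_pos.2 hr2
  have hs2 : s ^ 2 = 1 - r ^ 2 := Real.sq_sqrt hr2.le
  set v : ℝ≥0 := Real.toNNReal (s ^ 2) with hv
  have hvr : (v : ℝ) = s ^ 2 := Real.coe_toNNReal _ (sq_nonneg s)
  have hv0 : v ≠ 0 := by
    intro h0
    have : (v : ℝ) = 0 := by rw [h0]; simp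
    rw [hvr] at this
    exact (pow_pos hspos 2).ne' this
  set K : ℝ := (2 * Real.pi * s)⁻¹ * Real.exp (-w ^ 2 / (1 + |r|)) with hK
  have hinner : ∀ x : ℝ, ∫⁻ y, g (r * x + s * y) ∂(gaussianReal 0 1) =
      ∫⁻ y, gaussianPDF (r * x) v y * g y := by
    intro x
    have h1 : (gaussianReal 0 1).map (fun y => r * x + s * y) = gaussianReal (r * x) v := by
      have : (fun y : ℝ => r * x + s * y) = (fun y => r * x + y) ∘ (fun y => s * y) := rfl
      rw [this, ← Measure.map_map (by fun_prop) (by fun_prop), gaussianReal_map_const_mul,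
        gaussianReal_map_const_add, mul_zero, zero_add, mul_one]
      congr 1
      exact NNReal.eq hvr.symm
    rw [← lintegral_map (f := g) (g := fun y => r * x + s * y) hg (by fun_prop), h1,
      gaussianReal_of_var_ne_zero _ hv0,
      lintegral_withDensity_eq_lintegral_mul _ (measurable_gaussianPDF _ _) hg]
    rfl
  have hpt : ∀ x y : ℝ, gaussianPDF 0 1 x * (f x * (gaussianPDF (r * x) v y * g y)) ≤
      ENNReal.ofReal K * (f x * g y) := by
    intro x y
    by_cases hx : |x| < w
    · simp [hfw x hx]
    by_cases hy : |y| < w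
    · simp [hgw y hy]
    push Not at hx hy
    have : gaussianPDF 0 1 x * gaussianPDF (r * x) v y ≤ ENNReal.ofReal K := by
      rw [gaussianPDF, gaussianPDF, ← ENNReal.ofReal_mul (gaussianPDFReal_nonneg _ _ _)]
      refine ENNReal.ofReal_le_ofReal ?_
      rw [gaussianPDFReal, gaussianPDFReal, hvr, hK]
      have hc : (√(2 * Real.pi * ((1 : ℝ≥0) : ℝ)))⁻¹ * (√(2 * Real.pi * s ^ 2))⁻¹ =
          (2 * Real.pi * s)⁻¹ := by
        rw [← mul_inv, ← Real.sqrt_mul (by positivity)]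
        congr 1
        rw [show 2 * Real.pi * ((1 : ℝ≥0) : ℝ) * (2 * Real.pi * s ^ 2) = (2 * Real.pi * s) ^ 2 by
          push_cast; ring]
        exact Real.sqrt_sq (by positivity)
      rw [show ∀ A B C D : ℝ, A * B * (C * D) = A * C * (B * D) from fun A B C D => by ring, hc,
        ← Real.exp_add]
      refine mul_le_mul_of_nonneg_left (Real.exp_le_exp.2 ?_) (by positivity)
      have hra : 0 < 1 - |r| := by linarith
      have hrb : 0 < 1 + |r| := by positivity
      have hfac : s ^ 2 = (1 - |r|) * (1 + |r|) := by rw [hs2, ← sq_abs r]; ring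
      have hx2 : w ^ 2 ≤ x ^ 2 := by rw [← sq_abs x]; gcongr
      have hy2 : w ^ 2 ≤ y ^ 2 := by rw [← sq_abs y]; gcongr
      have hxy : 2 * (r * x * y) ≤ |r| * (x ^ 2 + y ^ 2) := by
        have h1 : r * x * y ≤ |r| * (|x| * |y|) := by
          rw [← abs_mul, ← abs_mul, ← mul_assoc]; exact le_abs_self _
        have h2 : 2 * (|x| * |y|) ≤ x ^ 2 + y ^ 2 := by
          rw [← sq_abs x, ← sq_abs y]; nlinarith [sq_nonneg (|x| - |y|)]
        nlinarith [abs_nonneg r]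
      have e1 : -(x - 0) ^ 2 / (2 * ((1 : ℝ≥0) : ℝ)) + -(y - r * x) ^ 2 / (2 * s ^ 2) =
          -(x ^ 2 - 2 * (r * x * y) + y ^ 2) / (2 * s ^ 2) := by
        have hs2' : s ^ 2 ≠ 0 := (pow_pos hspos 2).ne'
        field_simp
        rw [NNReal.coe_one, hs2]
        ring
      rw [e1, hfac, div_le_div_iff₀ (by positivity) hrb]
      have : 2 * w ^ 2 * (1 - |r|) ≤ x ^ 2 - 2 * (r * x * y) + y ^ 2 := by nlinarith
      nlinarith
    calc _ = gaussianPDF 0 1 x * gaussianPDF (r * x) v y * (f x * g y) := by ring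
      _ ≤ _ := by gcongr
  rw [bivLaw, lintegral_map (by fun_prop) (measurable_bivMap r), lintegral_prod _ (by fun_prop)]
  simp only
  have e2 : ∀ x : ℝ, ∫⁻ y, f x * g (r * x + s * y) ∂(gaussianReal 0 1) =
      f x * ∫⁻ y, gaussianPDF (r * x) v y * g y := by
    intro x
    rw [lintegral_const_mul _ (by fun_prop), hinner]
  have hmeas : Measurable fun x => f x * ∫⁻ y, gaussianPDF (r * x) v y * g y := by
    rw [funext fun x => (e2 x).symm]
    exact Measurable.lintegral_prod_right' (f := fun p : ℝ × ℝ => f p.1 * g (r * p.1 + s * p.2))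
      (by fun_prop)
  simp only [← hs, e2]
  rw [gaussianReal_of_var_ne_zero _ one_ne_zero,
    lintegral_withDensity_eq_lintegral_mul _ (measurable_gaussianPDF _ _) hmeas]
  calc ∫⁻ x, (gaussianPDF 0 1 * fun x => f x * ∫⁻ y, gaussianPDF (r * x) v y * g y) x
      ≤ ∫⁻ x, ∫⁻ y, ENNReal.ofReal K * (f x * g y) := by
        refine lintegral_mono fun x => ?_
        have hm : Measurable fun y => gaussianPDF (r * x) v y * g y :=
          (measurable_gaussianPDF _ _).mul hg
        rw [Pi.mul_apply, ← lintegral_const_mul _ hm, ← lintegral_const_mul _ (hm.const_mul _)]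
        exact lintegral_mono fun y => hpt x y
    _ = ENNReal.ofReal K * ((∫⁻ x, f x) * ∫⁻ x, g x) := by
        simp_rw [lintegral_const_mul _ (hg.const_mul _), lintegral_const_mul _ hg]
        rw [lintegral_const_mul _ (hf.mul_const _), lintegral_mul_const _ hf]

/-- The correlation `r` moves along the interpolation, so the bound may depend only on `R` and `σ`:
`R` in the exponent, where precision matters, and `σ` in the prefactor, which only has to stay
finite. -/
lemma integral_abs_mul_abs_le {μ : Measure (ι → ℝ)} {i j : ι} {r R σ w K : ℝ}
    (hμ : μ.map (fun x => (x i, x j)) = bivLaw r) (hrR : |r| ≤ R) (hR : R ≤ σ) (hσ : σ < 1)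
    (hw : 0 ≤ w) {F G : ℝ → ℝ} (hF : Continuous F) (hG : Continuous G)
    (hFw : ∀ x, |x| < w → F x = 0) (hGw : ∀ x, |x| < w → G x = 0) (hK : 0 ≤ K)
    (hFK : ∫⁻ x, ‖F x‖ₑ ≤ ENNReal.ofReal K) (hGK : ∫⁻ x, ‖G x‖ₑ ≤ ENNReal.ofReal K) :
    Integrable (fun x : ι → ℝ => |F (x i)| * |G (x j)|) μ ∧
      ∫ x, |F (x i)| * |G (x j)| ∂μ ≤
        K ^ 2 * (2 * Real.pi * √(1 - σ ^ 2))⁻¹ * Real.exp (-w ^ 2 / (1 + R)) := by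
  have hR0 : 0 ≤ R := (abs_nonneg r).trans hrR
  have hmain : ∫⁻ x, ‖|F (x i)| * |G (x j)|‖ₑ ∂μ ≤
      ENNReal.ofReal (K ^ 2 * (2 * Real.pi * √(1 - σ ^ 2))⁻¹ * Real.exp (-w ^ 2 / (1 + R))) := by
    have h1 : ∫⁻ x, ‖|F (x i)| * |G (x j)|‖ₑ ∂μ = ∫⁻ p, ‖F p.1‖ₑ * ‖G p.2‖ₑ ∂(bivLaw r) := by
      rw [← hμ, lintegral_map (by fun_prop) (by fun_prop)]
      refine lintegral_congr fun x => ?_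
      rw [enorm_mul]
      simp only [Real.enorm_eq_ofReal_abs, abs_abs]
    rw [h1]
    refine (lintegral_bivLaw_le (by linarith) hw hF.measurable.enorm hG.measurable.enorm
      (fun x hx => by simp [hFw x hx]) (fun x hx => by simp [hGw x hx])).trans ?_
    refine (mul_le_mul_right (mul_le_mul' hFK hGK) _).trans ?_
    rw [← ENNReal.ofReal_mul hK, ← ENNReal.ofReal_mul (by positivity)]
    refine ENNReal.ofReal_le_ofReal ?_
    have hsig : 0 < 1 - σ ^ 2 := by nlinarith
    have hle : 1 - σ ^ 2 ≤ 1 - r ^ 2 := by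
      rw [← sq_abs r]
      have : |r| ^ 2 ≤ σ ^ 2 := by gcongr; linarith
      linarith
    have e1 : (2 * Real.pi * √(1 - r ^ 2))⁻¹ ≤ (2 * Real.pi * √(1 - σ ^ 2))⁻¹ := by
      have := Real.sqrt_pos.2 hsig
      gcongr
    have e2 : Real.exp (-w ^ 2 / (1 + |r|)) ≤ Real.exp (-w ^ 2 / (1 + R)) := by
      rw [Real.exp_le_exp, neg_div, neg_div, neg_le_neg_iff]
      have : 0 < 1 + |r| := by positivity
      gcongr
    calc _ ≤ (2 * Real.pi * √(1 - σ ^ 2))⁻¹ * Real.exp (-w ^ 2 / (1 + R)) * (K * K) := by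
          gcongr
      _ = _ := by ring
  have hmeas : AEStronglyMeasurable (fun x : ι → ℝ => |F (x i)| * |G (x j)|) μ :=
    Continuous.aestronglyMeasurable (by fun_prop)
  refine ⟨⟨hmeas, hmain.trans_lt ENNReal.ofReal_lt_top⟩, ?_⟩
  rw [integral_eq_lintegral_of_nonneg_ae (ae_of_all _ fun x => by positivity) hmeas]
  refine ENNReal.toReal_le_of_le_ofReal (by positivity) (le_trans (le_of_eq ?_) hmain)
  refine lintegral_congr fun x => ?_
  rw [Real.enorm_of_nonneg (by positivity)]

end

/-! ### The normal comparison lemma -/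

section
variable {ι : Type*} [Fintype ι] [DecidableEq ι]

lemma lintegral_enorm_deriv_smoothCutoff_le {C : ℝ} (hC0 : 0 < C)
    (hC : ∀ x, |deriv Real.smoothTransition x| ≤ (Set.Icc (0:ℝ) 1).indicator (fun _ => C) x)
    (a b : ℝ) {ε : ℝ} (hε : 0 < ε) :
    ∫⁻ x, ‖deriv (smoothCutoff a b ε) x‖ₑ ≤ ENNReal.ofReal (2 * C) := by
  have hpos : 0 ≤ C / ε := by positivity
  have hI : ∀ c, ∫⁻ x, ENNReal.ofReal ((Set.Icc c (c + ε)).indicator (fun _ => C / ε) x) =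
      ENNReal.ofReal C := by
    intro c
    have : ∀ x, ENNReal.ofReal ((Set.Icc c (c + ε)).indicator (fun _ => C / ε) x) =
        (Set.Icc c (c + ε)).indicator (fun _ => ENNReal.ofReal (C / ε)) x := by
      intro x
      by_cases hx : x ∈ Set.Icc c (c + ε)
      · rw [Set.indicator_of_mem hx, Set.indicator_of_mem hx]
      · rw [Set.indicator_of_notMem hx, Set.indicator_of_notMem hx, ENNReal.ofReal_zero]
    simp_rw [this]
    rw [lintegral_indicator measurableSet_Icc, setLIntegral_const, Real.volume_Icc,
      ← ENNReal.ofReal_mul hpos]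
    congr 1
    field_simp
    ring
  calc ∫⁻ x, ‖deriv (smoothCutoff a b ε) x‖ₑ
      ≤ ∫⁻ x, (ENNReal.ofReal ((Set.Icc b (b + ε)).indicator (fun _ => C / ε) x) +
          ENNReal.ofReal ((Set.Icc a (a + ε)).indicator (fun _ => C / ε) x)) := by
        refine lintegral_mono fun x => ?_
        rw [Real.enorm_eq_ofReal_abs]
        rw [← ENNReal.ofReal_add (Set.indicator_nonneg (fun _ _ => hpos) _)
          (Set.indicator_nonneg (fun _ _ => hpos) _)]
        exact ENNReal.ofReal_le_ofReal (abs_deriv_smoothCutoff_le hC a b hε x)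
    _ = ENNReal.ofReal (2 * C) := by
        rw [lintegral_add_left, hI, hI, ← ENNReal.ofReal_add hC0.le hC0.le, two_mul]
        exact (measurable_const.indicator measurableSet_Icc).ennreal_ofReal

/-- A bump reaches from its end-point a distance `ε` to the right, hence up to `ε` closer to the
origin when the end-point is negative. -/
lemma deriv_smoothCutoff_eq_zero {C : ℝ}
    (hC : ∀ x, |deriv Real.smoothTransition x| ≤ (Set.Icc (0:ℝ) 1).indicator (fun _ => C) x)
    {a b w ε : ℝ} (hε : 0 < ε) (ha : w ≤ |a|) (hb : w ≤ |b|) {x : ℝ} (hx : |x| < w - ε) :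
    deriv (smoothCutoff a b ε) x = 0 := by
  have key : ∀ c, w ≤ |c| → x ∉ Set.Icc c (c + ε) := by
    rintro c hc ⟨h1, h2⟩
    have : |c| ≤ |x| + ε := by
      rw [abs_le]
      constructor
      · linarith [neg_abs_le x]
      · linarith [le_abs_self x]
    linarith
  have := abs_deriv_smoothCutoff_le hC a b hε x
  rw [Set.indicator_of_notMem (key b hb), Set.indicator_of_notMem (key a ha), add_zero] at this
  exact abs_nonpos_iff.1 this

/-- The normal comparison lemma for rectangles. -/
theorem normal_comparison {C : ℝ} (hC0 : 0 < C)
    (hC : ∀ x, |deriv Real.smoothTransition x| ≤ (Set.Icc (0:ℝ) 1).indicator (fun _ => C) x)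
    {μ₁ μ₀ : Measure (ι → ℝ)} [IsProbabilityMeasure μ₁]
    [IsProbabilityMeasure μ₀] {Λ₁ Λ₀ : ι → ι → ℝ} (h₁ : IsCenteredGaussian μ₁ Λ₁)
    (h₀ : IsCenteredGaussian μ₀ Λ₀) (hd₁ : ∀ i, Λ₁ i i = 1) (hd₀ : ∀ i, Λ₀ i i = 1)
    (hs₁ : ∀ i j, Λ₁ i j = Λ₁ j i) (hs₀ : ∀ i j, Λ₀ i j = Λ₀ j i) {σ : ℝ} (hσ : σ < 1)
    (hΛ : ∀ i j, Λ₁ i j ≠ Λ₀ i j → Λ₀ i j = 0 ∧ |Λ₁ i j| ≤ σ) {a b : ι → ℝ} {w : ℝ} (hw : 0 ≤ w)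
    (ha : ∀ i, w ≤ |a i|) (hb : ∀ i, w ≤ |b i|) :
    |μ₁.real (Set.univ.pi fun i => Set.Ioc (a i) (b i)) -
        μ₀.real (Set.univ.pi fun i => Set.Ioc (a i) (b i))| ≤
      (1 / 2) * ∑ i, ∑ j, |Λ₁ i j - Λ₀ i j| *
        ((2 * C) ^ 2 * (2 * Real.pi * √(1 - σ ^ 2))⁻¹ * Real.exp (-w ^ 2 / (1 + |Λ₁ i j|))) := by
  have hbox : ∀ (μ : Measure (ι → ℝ)) [IsProbabilityMeasure μ] (ε : ℕ → ℝ),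
      Tendsto ε atTop (𝓝[>] 0) →
      Tendsto (fun m => ∫ x, ∏ j, smoothCutoff (a j) (b j) (ε m) (x j) ∂μ) atTop
        (𝓝 (μ.real (Set.univ.pi fun i => Set.Ioc (a i) (b i)))) := by
    intro μ _ ε hε
    have hmeas : MeasurableSet (Set.univ.pi fun i => Set.Ioc (a i) (b i)) :=
      MeasurableSet.univ_pi fun i => measurableSet_Ioc
    rw [← integral_indicator_one hmeas]
    refine tendsto_integral_of_dominated_convergence (fun _ => 1) ?_ (integrable_const _) ?_ ?_
    · intro m
      have hc : ∀ j, Continuous (smoothCutoff (a j) (b j) (ε m)) := fun j =>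
        (contDiff_smoothCutoff _ _ _).continuous
      exact Continuous.aestronglyMeasurable (by fun_prop)
    · refine fun m => ae_of_all _ fun x => ?_
      rw [Real.norm_of_nonneg (Finset.prod_nonneg fun j _ => smoothCutoff_nonneg _ _ _ _)]
      exact Finset.prod_le_one (fun j _ => smoothCutoff_nonneg _ _ _ _)
        fun j _ => smoothCutoff_le_one _ _ _ _
    · refine ae_of_all _ fun x => ?_
      have h := tendsto_finsetProd (Finset.univ : Finset ι) fun j _ =>
        tendsto_smoothCutoff (a j) (b j) (x j) hε
      convert h using 2
      by_cases hx : x ∈ Set.univ.pi fun i => Set.Ioc (a i) (b i)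
      · rw [Set.indicator_of_mem hx, Pi.one_apply, Finset.prod_eq_one]
        intro j _
        rw [Set.indicator_of_mem (hx j (Set.mem_univ j))]
      · rw [Set.indicator_of_notMem hx]
        simp only [Set.mem_univ_pi, not_forall] at hx
        obtain ⟨j, hj⟩ := hx
        rw [Finset.prod_eq_zero (Finset.mem_univ j)]
        rw [Set.indicator_of_notMem hj]
  set ε : ℕ → ℝ := fun m => 1 / ((m : ℝ) + 1) with hε
  have hεpos : ∀ m, 0 < ε m := fun m => Nat.one_div_pos_of_nat
  have hε0 : Tendsto ε atTop (𝓝 0) := tendsto_one_div_add_atTop_nhds_zero_nat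
  have hεt : Tendsto ε atTop (𝓝[>] 0) :=
    tendsto_nhdsWithin_iff.2 ⟨hε0, Eventually.of_forall fun m => hεpos m⟩
  -- For positive `ε` the derivatives vanish only on `|x| < w - ε m`. The truncation at `0` keeps
  -- this level non-negative, and the exponent with `w` returns in the limit.
  have hR : Tendsto (fun m => (1 / 2) * ∑ i, ∑ j, |Λ₁ i j - Λ₀ i j| *
        ((2 * C) ^ 2 * (2 * Real.pi * √(1 - σ ^ 2))⁻¹ *
          Real.exp (-(max (w - ε m) 0) ^ 2 / (1 + |Λ₁ i j|)))) atTop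
      (𝓝 ((1 / 2) * ∑ i, ∑ j, |Λ₁ i j - Λ₀ i j| *
        ((2 * C) ^ 2 * (2 * Real.pi * √(1 - σ ^ 2))⁻¹ *
          Real.exp (-w ^ 2 / (1 + |Λ₁ i j|))))) := by
    refine Tendsto.const_mul _ (tendsto_finsetSum _ fun i _ => tendsto_finsetSum _ fun j _ =>
      Tendsto.const_mul _ (Tendsto.const_mul _ ?_))
    have h1 : Tendsto (fun m => max (w - ε m) 0) atTop (𝓝 w) := by
      have := (hε0.const_sub w).max (tendsto_const_nhds (x := (0:ℝ)))
      rwa [sub_zero, max_eq_left hw] at this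
    exact (Real.continuous_exp.tendsto _).comp (((h1.pow 2).neg).div_const _)
  refine le_of_tendsto_of_tendsto' ((hbox μ₁ ε hεt).sub (hbox μ₀ ε hεt)).abs hR fun m => ?_
  have hrep : ∀ j, ∃ ψ, HasFourierRep (smoothCutoff (a j) (b j) (ε m))
      (deriv (smoothCutoff (a j) (b j) (ε m))) ψ := fun j =>
    (hasCompactSupport_smoothCutoff _ _ (hεpos m)).exists_hasFourierRep (contDiff_smoothCutoff _ _ _)
  choose ψ hψ using hrep
  refine abs_integral_prod_sub_le h₁ h₀ (fun i => by rw [hd₁, hd₀]) hψ (fun j x => ?_) ?_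
  · rw [abs_of_nonneg (smoothCutoff_nonneg _ _ _ _)]; exact smoothCutoff_le_one _ _ _ _
  intro i j hij hne t ht
  obtain ⟨hz, hle⟩ := hΛ i j hne
  have hcg := h₁.interpLaw h₀ ht
  -- Where the matrices differ, `Λ₀ i j = 0`, so the correlation along the segment is `t * Λ₁ i j`,
  -- largest in modulus at the end.
  have hr : |t * Λ₁ i j + (1 - t) * Λ₀ i j| ≤ |Λ₁ i j| := by
    rw [hz, mul_zero, add_zero, abs_mul, abs_of_nonneg ht.1]
    exact mul_le_of_le_one_left (abs_nonneg _) ht.2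
  have hpair := hcg.map_pair hij (by rw [hd₁, hd₀]; ring) (by rw [hd₁, hd₀]; ring)
    (by rw [hs₁ i j, hs₀ i j]) (by linarith)
  have hcont : ∀ k, Continuous (deriv (smoothCutoff (a k) (b k) (ε m))) := fun k =>
    (contDiff_smoothCutoff _ _ _).continuous_deriv (by simp)
  have hzero : ∀ k x, |x| < max (w - ε m) 0 → deriv (smoothCutoff (a k) (b k) (ε m)) x = 0 := by
    intro k x hx
    rcases lt_max_iff.1 hx with hx | hx
    · exact deriv_smoothCutoff_eq_zero hC (hεpos m) (ha k) (hb k) hx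
    · exact absurd hx (not_lt.2 (abs_nonneg x))
  exact integral_abs_mul_abs_le hpair hr hle hσ (le_max_right _ _) (hcont i) (hcont j) (hzero i)
    (hzero j) (by positivity)
    (lintegral_enorm_deriv_smoothCutoff_le hC0 hC _ _ (hεpos m))
    (lintegral_enorm_deriv_smoothCutoff_le hC0 hC _ _ (hεpos m))

end

/-! ### Gaussian rows and independent blocks -/

section
variable {ι κ : Type*} [Fintype ι] [Fintype κ]

lemma isCenteredGaussian_map {Ω : Type*} [MeasurableSpace Ω] {P : Measure Ω}
    [IsProbabilityMeasure P] {X : ι → Ω → ℝ} (hX : HasGaussianLaw (fun ω i => X i ω) P)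
    (h0 : ∀ i, ∫ ω, X i ω ∂P = 0) :
    IsCenteredGaussian (P.map fun ω i => X i ω) (fun i j => cov[X i, X j; P]) := by
  intro ξ
  set L : StrongDual ℝ (ι → ℝ) := ∑ j, ξ j • ContinuousLinearMap.proj j with hL
  have hLx : ∀ x : ι → ℝ, L x = ∑ j, ξ j * x j := by
    intro x; simp [hL]
  have h := hX.charFunDual_map_eq_fun L
  have hmem : ∀ i, MemLp (X i) 2 P := fun i => (hX.eval i).memLp_two
  have hmean : ∫ ω, L (fun i => X i ω) ∂P = 0 := by
    simp_rw [hLx]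
    rw [integral_finsetSum _ fun i _ => ((hX.eval i).integrable).const_mul _]
    simp [integral_const_mul, h0]
  have hvar : Var[fun ω => L (fun i => X i ω); P] = quadForm (fun i j => cov[X i, X j; P]) ξ := by
    simp_rw [hLx]
    have hm : ∀ i, MemLp (fun ω => ξ i * X i ω) 2 P := fun i => (hmem i).const_mul _
    rw [← covariance_self (Finset.aemeasurable_fun_sum _ fun i _ => (hm i).aemeasurable),
      covariance_fun_sum_fun_sum hm hm, quadForm]
    refine Finset.sum_congr rfl fun i _ => Finset.sum_congr rfl fun j _ => ?_
    rw [covariance_const_mul_left, covariance_const_mul_right]; ring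
  rw [charFunDual_apply, hmean, hvar] at h
  simp_rw [hLx] at h
  rw [Complex.ofReal_exp]
  refine (integral_congr_ae (ae_of_all _ fun x => ?_)).trans (h.trans ?_)
  · rw [mul_comm]
  · push_cast
    congr 1; ring

/-- The law of independent blocks with common law `ν`. -/
noncomputable def blockLaw (ι : Type*) [Fintype ι] (ν : Measure (κ → ℝ)) :
    Measure (ι × κ → ℝ) :=
  (Measure.pi fun _ : ι => ν).map fun y p => y p.1 p.2

lemma measurable_uncurry_pi {ι κ : Type*} :
    Measurable fun (y : ι → κ → ℝ) (p : ι × κ) => y p.1 p.2 := by fun_prop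

instance (ν : Measure (κ → ℝ)) [IsProbabilityMeasure ν] : IsProbabilityMeasure (blockLaw ι ν) :=
  Measure.isProbabilityMeasure_map measurable_uncurry_pi.aemeasurable

lemma IsCenteredGaussian.blockLaw [DecidableEq ι] {ν : Measure (κ → ℝ)} [IsProbabilityMeasure ν]
    {S : κ → κ → ℝ} (h : IsCenteredGaussian ν S) :
    IsCenteredGaussian (blockLaw ι ν) (fun p q => if p.1 = q.1 then S p.2 q.2 else 0) := by
  intro ξ
  rw [_root_.blockLaw, integral_map measurable_uncurry_pi.aemeasurable
    (Continuous.aestronglyMeasurable (by fun_prop))]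
  have h1 : ∀ y : ι → κ → ℝ,
      Complex.exp (Complex.I * ((∑ p : ι × κ, ξ p * y p.1 p.2 : ℝ) : ℂ)) =
      ∏ k, Complex.exp (Complex.I * ((∑ i, ξ (k, i) * y k i : ℝ) : ℂ)) := by
    intro y
    rw [← Complex.exp_sum, ← Finset.mul_sum, ← Complex.ofReal_sum, Fintype.sum_prod_type]
  simp_rw [h1]
  rw [integral_fintype_prod_eq_prod
    (fun k (x : κ → ℝ) => Complex.exp (Complex.I * ((∑ i, ξ (k, i) * x i : ℝ) : ℂ)))]
  have h2 : ∀ k : ι, ∫ x : κ → ℝ, Complex.exp (Complex.I * ((∑ i, ξ (k, i) * x i : ℝ) : ℂ)) ∂ν =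
      (Real.exp (-quadForm S (fun i => ξ (k, i)) / 2) : ℂ) := fun k => h fun i => ξ (k, i)
  simp_rw [h2]
  rw [← Complex.ofReal_prod, ← Real.exp_sum, ← Finset.sum_div, Finset.sum_neg_distrib]
  congr 5
  simp only [quadForm, Fintype.sum_prod_type]
  refine Finset.sum_congr rfl fun k _ => Finset.sum_congr rfl fun i _ => ?_
  rw [Finset.sum_eq_single k]
  · simp
  · intro l _ hl; simp [hl.symm]
  · simp

lemma blockLaw_real_pi (ν : Measure (κ → ℝ)) [IsProbabilityMeasure ν] {s : κ → Set ℝ}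
    (hs : ∀ i, MeasurableSet (s i)) :
    (blockLaw ι ν).real (Set.univ.pi fun p : ι × κ => s p.2) =
      ν.real (Set.univ.pi s) ^ Fintype.card ι := by
  rw [blockLaw, map_measureReal_apply measurable_uncurry_pi
    (MeasurableSet.univ_pi fun p => hs p.2)]
  have : (fun (y : ι → κ → ℝ) (p : ι × κ) => y p.1 p.2) ⁻¹'
      (Set.univ.pi fun p : ι × κ => s p.2) = Set.univ.pi fun _ : ι => Set.univ.pi s := by
    ext y; simp [Prod.forall]
  rw [this, measureReal_def, Measure.pi_pi, Finset.prod_const, ENNReal.toReal_pow]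
  rfl

/-- The bivariate law `bivLaw r` on `Fin 2 → ℝ`. -/
noncomputable def bivLawPi (r : ℝ) : Measure (Fin 2 → ℝ) := (bivLaw r).map fun p => ![p.1, p.2]

lemma measurable_vecCons : Measurable fun p : ℝ × ℝ => ![p.1, p.2] := by
  rw [measurable_pi_iff]; intro i; fin_cases i
  · exact measurable_fst
  · exact measurable_snd

instance (r : ℝ) : IsProbabilityMeasure (bivLawPi r) :=
  Measure.isProbabilityMeasure_map measurable_vecCons.aemeasurable

lemma isCenteredGaussian_bivLawPi {r : ℝ} (hr : |r| ≤ 1) :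
    IsCenteredGaussian (bivLawPi r) (fun i j => if i = j then 1 else r) := by
  intro ξ
  rw [bivLawPi, integral_map measurable_vecCons.aemeasurable
    (Continuous.aestronglyMeasurable (by fun_prop))]
  simp only [Fin.sum_univ_two, Matrix.cons_val_zero, Matrix.cons_val_one]
  rw [integral_exp_bivLaw hr]
  congr 3
  simp [quadForm, Fin.sum_univ_two]
  ring

lemma bivLawPi_real_pi (r : ℝ) {s : Fin 2 → Set ℝ} (hs : ∀ i, MeasurableSet (s i)) :
    (bivLawPi r).real (Set.univ.pi s) = (bivLaw r).real (s 0 ×ˢ s 1) := by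
  rw [bivLawPi, map_measureReal_apply measurable_vecCons (MeasurableSet.univ_pi hs)]
  congr 1
  ext p; simp [Fin.forall_fin_two]

end

/-! ### Asymptotics of the levels -/

section Levels

/-- `κ_n = 2 ln n - ln (4 π ln n) / 2`, so that `√(2 ln n) u_n(z) = z + κ_n`. -/
noncomputable def levelShift (n : ℕ) : ℝ :=
  2 * Real.log n - 1 / 2 * Real.log (4 * Real.pi * Real.log n)

lemma tendsto_log_natCast : Tendsto (fun n : ℕ => Real.log n) atTop atTop :=
  Real.tendsto_log_atTop.comp tendsto_natCast_atTop_atTop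

lemma log_natCast_pos {n : ℕ} (hn : 2 ≤ n) : 0 < Real.log n :=
  Real.log_pos (by exact_mod_cast hn)

lemma sqrt_two_log_pos {n : ℕ} (hn : 2 ≤ n) : 0 < √(2 * Real.log n) :=
  Real.sqrt_pos.2 (by have := log_natCast_pos hn; positivity)

lemma sqrt_mul_normLevel {n : ℕ} (hn : 2 ≤ n) (z : ℝ) :
    √(2 * Real.log n) * normLevel n z = z + levelShift n := by
  have hs := sqrt_two_log_pos hn
  have hL := log_natCast_pos hn
  have h2 : √(2 * Real.log n) ^ 2 = 2 * Real.log n := Real.sq_sqrt (by positivity)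
  rw [normLevel, scaleConst, locConst, levelShift]
  field_simp
  rw [h2]
  ring

lemma normLevel_strictMono {n : ℕ} (hn : 2 ≤ n) : StrictMono (normLevel n) := by
  intro a b hab
  have hs := sqrt_two_log_pos hn
  refine lt_of_mul_lt_mul_left ?_ hs.le
  rw [sqrt_mul_normLevel hn, sqrt_mul_normLevel hn]
  linarith

/-- The expansion is kept exact because it serves twice: the last term gives the correction factor
of the density, and dropping it gives a lower bound for the Berman sum. -/
lemma normLevel_sq {n : ℕ} (hn : 2 ≤ n) (z : ℝ) :
    normLevel n z ^ 2 = 2 * Real.log n + 2 * (z - 1 / 2 * Real.log (4 * Real.pi * Real.log n)) +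
      (z - 1 / 2 * Real.log (4 * Real.pi * Real.log n)) ^ 2 / (2 * Real.log n) := by
  have hs := sqrt_two_log_pos hn
  have hL := log_natCast_pos hn
  have h2 : √(2 * Real.log n) ^ 2 = 2 * Real.log n := Real.sq_sqrt (by positivity)
  have h3 : 2 * Real.log n * normLevel n z ^ 2 = (z + levelShift n) ^ 2 := by
    rw [← sqrt_mul_normLevel hn, mul_pow, h2]
  rw [levelShift] at h3
  have h4 : normLevel n z ^ 2 =
      (z + (2 * Real.log n - 1 / 2 * Real.log (4 * Real.pi * Real.log n))) ^ 2 /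
        (2 * Real.log n) := by
    rw [← h3]; field_simp
  rw [h4]
  field_simp
  ring

/-- The Gaussian density at the level `u_n(z)`, normalised by `n a_n`. -/
lemma natCast_mul_pdf_normLevel {n : ℕ} (hn : 2 ≤ n) (z : ℝ) :
    n * (scaleConst n * gaussianPDFReal 0 1 (normLevel n z)) = Real.exp (-z) *
      Real.exp (-(z - 1 / 2 * Real.log (4 * Real.pi * Real.log n)) ^ 2 / (4 * Real.log n)) := by
  have hs := sqrt_two_log_pos hn
  have hL := log_natCast_pos hn
  have hn0 : (0:ℝ) < n := by positivity
  rw [gaussianPDFReal, scaleConst, sub_zero, normLevel_sq hn]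
  set ℓ := Real.log (4 * Real.pi * Real.log n) with hℓ
  have hexp : Real.exp (1 / 2 * ℓ) = √(4 * Real.pi * Real.log n) := by
    rw [Real.sqrt_eq_rpow, Real.rpow_def_of_pos (by positivity)]
    congr 1; ring
  have e1 : -(2 * Real.log n + 2 * (z - 1 / 2 * ℓ) + (z - 1 / 2 * ℓ) ^ 2 / (2 * Real.log n)) /
      (2 * ((1 : ℝ≥0) : ℝ)) =
      -Real.log n + (-z + 1 / 2 * ℓ + -(z - 1 / 2 * ℓ) ^ 2 / (4 * Real.log n)) := by
    rw [NNReal.coe_one]; field_simp; ring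
  rw [e1, Real.exp_add, Real.exp_add, Real.exp_add, hexp, Real.exp_neg, Real.exp_log hn0]
  have e2 : √(4 * Real.pi * Real.log n) = √(2 * Real.pi * ((1 : ℝ≥0) : ℝ)) * √(2 * Real.log n) := by
    rw [← Real.sqrt_mul (by positivity)]
    congr 1; rw [NNReal.coe_one]; ring
  rw [e2]
  have : 0 < √(2 * Real.pi * ((1 : ℝ≥0) : ℝ)) := Real.sqrt_pos.2 (by rw [NNReal.coe_one]; positivity)
  field_simp

lemma tendsto_loglog_div_log :
    Tendsto (fun n : ℕ => Real.log (4 * Real.pi * Real.log n) ^ 2 / Real.log n) atTop (𝓝 0) := by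
  have h1 : Tendsto (fun n : ℕ => 4 * Real.pi * Real.log n) atTop atTop :=
    tendsto_log_natCast.const_mul_atTop (by positivity)
  have h2 : Tendsto (fun x : ℝ => Real.log x ^ 2 / x) atTop (𝓝 0) := by
    have := Real.tendsto_pow_log_div_mul_add_atTop 1 0 2 one_ne_zero
    simpa using this
  have h3 := (h2.comp h1).const_mul (4 * Real.pi)
  rw [mul_zero] at h3
  refine h3.congr fun n => ?_
  simp only [Function.comp]
  have := Real.pi_pos
  field_simp

lemma tendsto_loglog_div_log' :
    Tendsto (fun n : ℕ => Real.log (4 * Real.pi * Real.log n) / Real.log n) atTop (𝓝 0) := by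
  have h1 : Tendsto (fun n : ℕ => 4 * Real.pi * Real.log n) atTop atTop :=
    tendsto_log_natCast.const_mul_atTop (by positivity)
  have h2 : Tendsto (fun x : ℝ => Real.log x / x) atTop (𝓝 0) := by
    have := Real.tendsto_pow_log_div_mul_add_atTop 1 0 1 one_ne_zero
    simpa using this
  have h3 := (h2.comp h1).const_mul (4 * Real.pi)
  rw [mul_zero] at h3
  refine h3.congr fun n => ?_
  simp only [Function.comp]
  have := Real.pi_pos
  field_simp

lemma tendsto_levelShift_div_log :
    Tendsto (fun n : ℕ => levelShift n / Real.log n) atTop (𝓝 2) := by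
  have h := (tendsto_loglog_div_log'.const_mul (1 / 2)).const_sub 2
  rw [mul_zero, sub_zero] at h
  refine h.congr' ?_
  filter_upwards [eventually_ge_atTop 2] with n hn
  have hL := log_natCast_pos hn
  rw [levelShift]
  field_simp

lemma tendsto_density_correction (z : ℝ) :
    Tendsto (fun n : ℕ => Real.exp (-z) *
      Real.exp (-(z - 1 / 2 * Real.log (4 * Real.pi * Real.log n)) ^ 2 / (4 * Real.log n)))
      atTop (𝓝 (Real.exp (-z))) := by
  have h1 : Tendsto (fun n : ℕ => z ^ 2 / (4 * Real.log n)) atTop (𝓝 0) :=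
    tendsto_const_nhds.div_atTop (tendsto_log_natCast.const_mul_atTop (by positivity))
  have h2 := tendsto_loglog_div_log'.const_mul (z / 4)
  have h3 := tendsto_loglog_div_log.const_mul (1 / 16)
  have h4 := ((h1.sub h2).add h3).neg
  have h5 : Tendsto (fun n : ℕ => -(z - 1 / 2 * Real.log (4 * Real.pi * Real.log n)) ^ 2 /
      (4 * Real.log n)) atTop (𝓝 0) := by
    rw [show (0:ℝ) = -(0 - z / 4 * 0 + 1 / 16 * 0) by ring]
    refine h4.congr' ?_
    filter_upwards [eventually_ge_atTop 2] with n hn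
    have hL := log_natCast_pos hn
    field_simp
    ring
  have := ((Real.continuous_exp.tendsto 0).comp h5).const_mul (Real.exp (-z))
  simpa using this

end Levels

/-! ### Rare events for a pair of independent normal variables -/

section Tail

/-- Fubini and the substitution `t = u_n(z)` in the first coordinate, whose density times `n a_n` is
`e^{-z}` up to a factor that is at most `1` and tends to `1`. By `hAx` the sections with `z < x` are
empty. -/
lemma natCast_mul_real_prod_gaussian {n : ℕ} (hn : 2 ≤ n) {x : ℝ} {A : Set (ℝ × ℝ)}
    (hA : MeasurableSet A) (hAx : ∀ p ∈ A, normLevel n x ≤ p.1) :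
    n * ((gaussianReal 0 1).prod (gaussianReal 0 1)).real A = ∫ z in Set.Ioi x,
      (Real.exp (-z) *
        Real.exp (-(z - 1 / 2 * Real.log (4 * Real.pi * Real.log n)) ^ 2 / (4 * Real.log n))) *
      (gaussianReal 0 1).real {w | (normLevel n z, w) ∈ A} := by
  have ha : 0 < scaleConst n := by
    rw [scaleConst]; have := sqrt_two_log_pos hn; positivity
  set h : ℝ → ℝ := fun t => (gaussianReal 0 1).real {w | (t, w) ∈ A} with hh
  have e1 : ((gaussianReal 0 1).prod (gaussianReal 0 1)).real A =
      ∫ t, gaussianPDFReal 0 1 t * h t := by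
    have h1 : ((gaussianReal 0 1).prod (gaussianReal 0 1)).real A =
        ∫ t, h t ∂(gaussianReal 0 1) := by
      have hi : Integrable (A.indicator (1 : ℝ × ℝ → ℝ))
          ((gaussianReal 0 1).prod (gaussianReal 0 1)) := (integrable_const (1:ℝ)).indicator hA
      rw [← integral_indicator_one hA, integral_prod _ hi]
      refine integral_congr_ae (ae_of_all _ fun t => ?_)
      simp only [hh]
      exact integral_indicator_one (measurable_prodMk_left hA)
    rw [h1, integral_gaussianReal_eq_integral_smul one_ne_zero]
    rfl
  have e2 : ∫ t, gaussianPDFReal 0 1 t * h t =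
      scaleConst n * ∫ z, gaussianPDFReal 0 1 (normLevel n z) * h (normLevel n z) := by
    have h2 := MeasureTheory.Measure.integral_comp_mul_left
      (fun t => gaussianPDFReal 0 1 (t + locConst n) * h (t + locConst n)) (scaleConst n)
    have h3 := integral_add_right_eq_self (μ := volume)
      (fun t => gaussianPDFReal 0 1 t * h t) (locConst n)
    rw [h3, abs_of_pos (inv_pos.2 ha), smul_eq_mul] at h2
    simp only [normLevel]
    rw [h2]; field_simp
  rw [e1, e2, ← integral_const_mul, ← integral_const_mul]
  have e3 : ∀ z, (n:ℝ) * (scaleConst n * (gaussianPDFReal 0 1 (normLevel n z) *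
      h (normLevel n z))) = (Real.exp (-z) *
        Real.exp (-(z - 1 / 2 * Real.log (4 * Real.pi * Real.log n)) ^ 2 / (4 * Real.log n))) *
        h (normLevel n z) := by
    intro z; rw [← natCast_mul_pdf_normLevel hn]; ring
  simp_rw [e3]
  rw [← integral_Ici_eq_integral_Ioi, setIntegral_eq_integral_of_forall_compl_eq_zero]
  intro z hz
  rw [Set.mem_Ici, not_le] at hz
  have : h (normLevel n z) = 0 := by
    simp only [hh]
    have : {w | (normLevel n z, w) ∈ A} = ∅ := by
      ext w
      simp only [Set.mem_ofPred_eq, Set.mem_empty_iff_false, iff_false]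
      intro hw
      exact absurd (hAx _ hw) (not_le.2 (normLevel_strictMono hn hz))
    rw [this]; simp
  exact mul_eq_zero_of_right _ this

lemma tendsto_measureReal_of_ae_eventually_iff {α : Type*} [MeasurableSpace α] {μ : Measure α}
    [IsProbabilityMeasure μ] {A : ℕ → Set α} {B : Set α} (hA : ∀ n, MeasurableSet (A n))
    (hB : MeasurableSet B) (h : ∀ᵐ w ∂μ, ∀ᶠ n in atTop, (w ∈ A n ↔ w ∈ B)) :
    Tendsto (fun n => μ.real (A n)) atTop (𝓝 (μ.real B)) := by
  have := tendsto_measure_of_ae_tendsto_indicator_of_isFiniteMeasure atTop (μ := μ) hB hA h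
  exact (ENNReal.tendsto_toReal (measure_ne_top _ _)).comp this

/-- Limits of rare-event probabilities for a pair of independent normal variables, the first of
which exceeds a high level. -/
lemma tendsto_natCast_mul_real_prod_gaussian {x : ℝ} {A : ℕ → Set (ℝ × ℝ)}
    (hA : ∀ n, MeasurableSet (A n)) (hAx : ∀ n, ∀ p ∈ A n, normLevel n x ≤ p.1) {B : ℝ → Set ℝ}
    (hB : ∀ z, MeasurableSet (B z))
    (h : ∀ᵐ z ∂(volume.restrict (Set.Ioi x)), ∀ᵐ w ∂(gaussianReal 0 1),
      ∀ᶠ n in atTop, ((normLevel n z, w) ∈ A n ↔ w ∈ B z)) :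
    Tendsto (fun n : ℕ => n * ((gaussianReal 0 1).prod (gaussianReal 0 1)).real (A n)) atTop
      (𝓝 (∫ z in Set.Ioi x, Real.exp (-z) * (gaussianReal 0 1).real (B z))) := by
  have hlim : Tendsto (fun n : ℕ => ∫ z in Set.Ioi x,
      (Real.exp (-z) *
        Real.exp (-(z - 1 / 2 * Real.log (4 * Real.pi * Real.log n)) ^ 2 / (4 * Real.log n))) *
      (gaussianReal 0 1).real {w | (normLevel n z, w) ∈ A n}) atTop
      (𝓝 (∫ z in Set.Ioi x, Real.exp (-z) * (gaussianReal 0 1).real (B z))) := by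
    -- The bound `e^{-z}` holds for all `n`: the correction factor is at most `1`, also for `n ≤ 1`,
    -- where the division by `ln n = 0` makes its exponent `0`.
    refine tendsto_integral_of_dominated_convergence (fun z => Real.exp (-z)) ?_
      (integrableOn_exp_neg_Ioi x) ?_ ?_
    · intro n
      have hm : Measurable fun t => (gaussianReal 0 1).real {w | (t, w) ∈ A n} :=
        (measurable_measure_prodMk_left (hA n)).ennreal_toReal
      have hu : Measurable (normLevel n) := by unfold normLevel; fun_prop
      refine Measurable.aestronglyMeasurable ?_
      exact Measurable.mul (by fun_prop) (hm.comp hu)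
    · intro n
      refine ae_of_all _ fun z => ?_
      rw [Real.norm_of_nonneg (by positivity), mul_assoc]
      refine mul_le_of_le_one_right (Real.exp_pos _).le (mul_le_one₀ ?_ measureReal_nonneg
        measureReal_le_one)
      rw [Real.exp_le_one_iff]
      have : 0 ≤ Real.log n := Real.log_natCast_nonneg n
      rw [neg_div]
      exact neg_nonpos.2 (by positivity)
    · filter_upwards [h] with z hz
      exact (tendsto_density_correction z).mul
        (tendsto_measureReal_of_ae_eventually_iff (fun n => measurable_prodMk_left (hA n)) (hB z) hz)
  refine hlim.congr' ?_
  filter_upwards [eventually_ge_atTop 2] with n hn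
  exact (natCast_mul_real_prod_gaussian hn (hA n) (hAx n)).symm

end Tail

/-! ### One formula for all Hüsler-Reiss limits -/

section HuslerReiss

/-- The limit of `n ℙ(ξ₁ > u_n(x), ξ₂ ≤ u_n(y))`. -/
noncomputable def tailLimit (lam : ℝ≥0∞) (x y : ℝ) : ℝ :=
  ∫ z in Set.Ioi x, Real.exp (-z) * (gaussianReal 0 1).real
    {w | lam = ⊤ ∨ 2 * lam.toReal * w ≤ y - z + 2 * lam.toReal ^ 2}

lemma stdNormalCDF_eq_real (x : ℝ) : stdNormalCDF x = (gaussianReal 0 1).real (Set.Iic x) := by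
  rw [stdNormalCDF, cdf_eq_real]

lemma stdNormalCDF_eq_integral (x : ℝ) :
    stdNormalCDF x = ∫ t in Set.Iic x, gaussianPDFReal 0 1 t := by
  rw [stdNormalCDF_eq_real, measureReal_def, gaussianReal_apply_eq_integral _ one_ne_zero,
    ENNReal.toReal_ofReal]
  exact integral_nonneg fun t => gaussianPDFReal_nonneg _ _ _

lemma continuous_gaussianPDFReal_std : Continuous (gaussianPDFReal 0 1) := by
  rw [gaussianPDFReal_def]; fun_prop

lemma hasDerivAt_stdNormalCDF (x : ℝ) : HasDerivAt stdNormalCDF (gaussianPDFReal 0 1 x) x := by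
  have h1 : ∀ y, stdNormalCDF y = stdNormalCDF 0 + ∫ t in (0:ℝ)..y, gaussianPDFReal 0 1 t := by
    intro y
    rw [stdNormalCDF_eq_integral, stdNormalCDF_eq_integral,
      ← intervalIntegral.integral_Iic_sub_Iic (integrable_gaussianPDFReal 0 1).integrableOn
        (integrable_gaussianPDFReal 0 1).integrableOn]
    ring
  rw [funext h1]
  exact (intervalIntegral.integral_hasDerivAt_right
    (continuous_gaussianPDFReal_std.intervalIntegrable _ _)
    (continuous_gaussianPDFReal_std.stronglyMeasurableAtFilter _ _)
    continuous_gaussianPDFReal_std.continuousAt).const_add _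

lemma tendsto_stdNormalCDF_atTop : Tendsto stdNormalCDF atTop (𝓝 1) := tendsto_cdf_atTop _

lemma stdNormalCDF_nonneg (x : ℝ) : 0 ≤ stdNormalCDF x := cdf_nonneg _ _

lemma stdNormalCDF_le_one (x : ℝ) : stdNormalCDF x ≤ 1 := cdf_le_one _ _

/-- An explicit antiderivative `G` exists because `e^{-z} φ(l + (y - z)/(2l)) = e^{-y} φ(l + (z -
y)/(2l))` for the normal density `φ`, so the two density terms in `G'` cancel. -/
lemma integral_exp_mul_stdNormalCDF {l : ℝ} (hl : 0 < l) (x y : ℝ) :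
    ∫ z in Set.Ioi x, Real.exp (-z) * stdNormalCDF (l + (y - z) / (2 * l)) =
      stdNormalCDF (l + (x - y) / (2 * l)) * Real.exp (-y) +
        stdNormalCDF (l + (y - x) / (2 * l)) * Real.exp (-x) - Real.exp (-y) := by
  set G : ℝ → ℝ := fun z => -(Real.exp (-z) * stdNormalCDF (l + (y - z) / (2 * l))) -
    Real.exp (-y) * stdNormalCDF (l + (z - y) / (2 * l)) with hG
  have hder : ∀ z, HasDerivAt G (Real.exp (-z) * stdNormalCDF (l + (y - z) / (2 * l))) z := by
    intro z
    have a1 : HasDerivAt (fun z => l + (y - z) / (2 * l)) (-1 / (2 * l)) z :=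
      (((hasDerivAt_id z).const_sub y).div_const (2 * l)).const_add l
    have a2 : HasDerivAt (fun z => l + (z - y) / (2 * l)) (1 / (2 * l)) z :=
      (((hasDerivAt_id z).sub_const y).div_const (2 * l)).const_add l
    have a3 : HasDerivAt (fun z => Real.exp (-z)) (Real.exp (-z) * -1) z :=
      ((hasDerivAt_id z).neg).exp
    have b1 := (a3.mul ((hasDerivAt_stdNormalCDF _).comp z a1)).neg
    have b2 := (((hasDerivAt_stdNormalCDF _).comp z a2)).const_mul (Real.exp (-y))
    refine (b1.sub b2).congr_deriv ?_
    have key : Real.exp (-z) * gaussianPDFReal 0 1 (l + (y - z) / (2 * l)) =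
        Real.exp (-y) * gaussianPDFReal 0 1 (l + (z - y) / (2 * l)) := by
      simp only [gaussianPDFReal]
      rw [mul_left_comm, mul_left_comm (Real.exp (-y)), ← Real.exp_add, ← Real.exp_add]
      congr 2
      rw [NNReal.coe_one]
      field_simp
      ring
    simp only [Function.comp]
    linear_combination (1 / (2 * l)) * key
  have hint : IntegrableOn (fun z => Real.exp (-z) * stdNormalCDF (l + (y - z) / (2 * l)))
      (Set.Ioi x) := by
    have hc : Continuous stdNormalCDF :=
      continuous_iff_continuousAt.2 fun z => (hasDerivAt_stdNormalCDF z).continuousAt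
    refine (integrableOn_exp_neg_Ioi x).mul_bdd (c := 1)
      (Continuous.aestronglyMeasurable (by fun_prop)) (ae_of_all _ fun z => ?_)
    rw [Real.norm_of_nonneg (stdNormalCDF_nonneg _)]
    exact stdNormalCDF_le_one _
  have hlim : Tendsto G atTop (𝓝 (-Real.exp (-y))) := by
    have c1 : Tendsto (fun z => Real.exp (-z) * stdNormalCDF (l + (y - z) / (2 * l))) atTop (𝓝 0) := by
      refine squeeze_zero (fun z => mul_nonneg (Real.exp_pos _).le (stdNormalCDF_nonneg _))
        (fun z => mul_le_of_le_one_right (Real.exp_pos _).le (stdNormalCDF_le_one _)) ?_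
      exact Real.tendsto_exp_neg_atTop_nhds_zero
    have c2 : Tendsto (fun z => l + (z - y) / (2 * l)) atTop atTop := by
      refine tendsto_atTop_add_const_left _ _ (Tendsto.atTop_div_const (by positivity) ?_)
      exact tendsto_atTop_add_const_right _ _ tendsto_id
    have c3 := (tendsto_stdNormalCDF_atTop.comp c2).const_mul (Real.exp (-y))
    have := c1.neg.sub c3
    simpa [hG] using this
  rw [integral_Ioi_of_hasDerivAt_of_tendsto' (fun z _ => hder z) hint hlim]
  simp only [hG]
  ring

/-- This form merges the three cases of the definition, so the tail limit needs computing only once.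
The exponent splits the event that some component exceeds its level according to whether the second
one does. -/
lemma huslerReissCDF_eq_exp (lam : ℝ≥0∞) (x y : ℝ) :
    huslerReissCDF lam x y = Real.exp (-(Real.exp (-y) + tailLimit lam x y)) := by
  rw [huslerReissCDF, tailLimit]
  by_cases h0 : lam = 0
  · subst h0
    simp only [if_true, ENNReal.zero_ne_top, false_or, ENNReal.toReal_zero, mul_zero, zero_mul,
      ne_eq, OfNat.ofNat_ne_zero, not_false_eq_true, zero_pow, add_zero]
    -- At `λ = 0` the set of `w` is everything or empty, so the integral is cut off at `y`.
    have h1 : ∫ z in Set.Ioi x, Real.exp (-z) * (gaussianReal 0 1).real {_w | 0 ≤ y - z} =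
        ∫ z in Set.Ioc x y, Real.exp (-z) := by
      have : ∀ z, Real.exp (-z) * (gaussianReal 0 1).real {_w | 0 ≤ y - z} =
          (Set.Iic y).indicator (fun z => Real.exp (-z)) z := by
        intro z
        by_cases hz : z ≤ y
        · rw [Set.indicator_of_mem (Set.mem_Iic.2 hz)]
          simp [hz]
        · rw [Set.indicator_of_notMem (by simpa using hz)]
          simp [hz]
      simp_rw [this]
      rw [setIntegral_indicator measurableSet_Iic]
      rfl
    rw [h1]
    rcases le_total x y with hxy | hxy
    · have h2 : ∫ z in Set.Ioc x y, Real.exp (-z) = Real.exp (-x) - Real.exp (-y) := by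
        rw [← intervalIntegral.integral_of_le hxy]
        simp
      rw [h2, min_eq_left]
      · rw [gumbelCDF]; congr 1; ring
      · rw [gumbelCDF, gumbelCDF]; gcongr
    · rw [Set.Ioc_eq_empty (not_lt.2 hxy), min_eq_right]
      · rw [gumbelCDF]; simp
      · rw [gumbelCDF, gumbelCDF]; gcongr
  by_cases ht : lam = ⊤
  · subst ht
    simp only [h0, if_false, if_true, true_or, Set.ofPred_true, probReal_univ, mul_one,
      integral_exp_neg_Ioi, gumbelCDF, ← Real.exp_add]
    congr 1; ring
  have hl : 0 < lam.toReal := ENNReal.toReal_pos h0 ht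
  rw [if_neg h0, if_neg ht]
  have h1 : ∀ z, {w | lam = ⊤ ∨ 2 * lam.toReal * w ≤ y - z + 2 * lam.toReal ^ 2} =
      Set.Iic (lam.toReal + (y - z) / (2 * lam.toReal)) := by
    intro z
    ext w
    simp only [ht, false_or, Set.mem_ofPred_eq, Set.mem_Iic]
    have e : lam.toReal + (y - z) / (2 * lam.toReal) =
        (y - z + 2 * lam.toReal ^ 2) / (2 * lam.toReal) := by field_simp; ring
    rw [e, le_div_iff₀ (by positivity), mul_comm]
  simp_rw [h1, ← stdNormalCDF_eq_real]
  rw [integral_exp_mul_stdNormalCDF hl]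
  congr 1; ring

end HuslerReiss

/-! ### Tails of a correlated pair -/

section BivariateTails

/-- Scaling by `√(2 ln n)` separates a noise term with coefficient `√(2 ln n (1 - r²))` from the
drift `(1 - r) levelShift n`, which behaves like `2 (1 - r) ln n`. -/
lemma sqrt_mul_conditional {n : ℕ} (hn : 2 ≤ n) (r z w y : ℝ) :
    √(2 * Real.log n) * (r * normLevel n z + √(1 - r ^ 2) * w - normLevel n y) =
      √(2 * Real.log n * (1 - r ^ 2)) * w + r * z - y - (1 - r) * levelShift n := by
  have hL := log_natCast_pos hn
  rw [Real.sqrt_mul (x := 2 * Real.log n) (by positivity) (1 - r ^ 2), show ∀ s a b c : ℝ, s * (r * a + b - c) =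
    r * (s * a) + s * b - s * c from fun s a b c => by ring, sqrt_mul_normLevel hn,
    sqrt_mul_normLevel hn]
  ring

lemma conditional_lt_iff {n : ℕ} (hn : 2 ≤ n) (r z w y : ℝ) :
    r * normLevel n z + √(1 - r ^ 2) * w < normLevel n y ↔
      √(2 * Real.log n * (1 - r ^ 2)) * w + r * z - y - (1 - r) * levelShift n < 0 := by
  have hs := sqrt_two_log_pos hn
  rw [← sqrt_mul_conditional hn, ← sub_neg]
  exact ⟨fun h => mul_neg_of_pos_of_neg hs h,
    fun h => lt_of_mul_lt_mul_left (by rwa [mul_zero]) hs.le⟩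

/-- With `τ = (1 - ρ n) ln n → ∞`, the drift is at least `τ` while the noise is at most `2 √τ |w|`,
so the drift wins. -/
lemma eventually_conditional_lt {ρ : ℕ → ℝ} (hρ : ∀ᶠ n in atTop, |ρ n| ≤ 1)
    (h : Tendsto (fun n : ℕ => (1 - ρ n) * Real.log n) atTop atTop) (z w y : ℝ) :
    ∀ᶠ n in atTop, ρ n * normLevel n z + √(1 - ρ n ^ 2) * w < normLevel n y := by
  have hshift : ∀ᶠ n : ℕ in atTop, 1 < levelShift n / Real.log n :=
    tendsto_levelShift_div_log.eventually_const_lt (by norm_num)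
  -- The threshold comes from `2 √τ |w| ≤ τ / 4 + 4 w²`: it suffices that `3τ / 4` exceeds `|z| +
  -- |y| + 4 w²`.
  filter_upwards [hρ, eventually_ge_atTop 2, hshift,
    h.eventually_gt_atTop (max 0 (2 * (|z| + |y|) + 16 * w ^ 2))] with n hr hn hsh hτ
  have hL := log_natCast_pos hn
  rw [conditional_lt_iff hn]
  rw [one_lt_div hL] at hsh
  set τ := (1 - ρ n) * Real.log n with hτdef
  have hτ0 : 0 < τ := (le_max_left _ _).trans_lt hτ
  have hτ1 : 2 * (|z| + |y|) + 16 * w ^ 2 < τ := (le_max_right _ _).trans_lt hτ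
  obtain ⟨hr1, hr2⟩ := abs_le.1 hr
  have hc : √(2 * Real.log n * (1 - ρ n ^ 2)) ≤ 2 * √τ := by
    rw [show 2 * √τ = √(4 * τ) by
      rw [Real.sqrt_mul (x := 4) (by norm_num) τ, show (4:ℝ) = 2 ^ 2 by norm_num,
        Real.sqrt_sq (by norm_num)]]
    refine Real.sqrt_le_sqrt ?_
    have : 2 * Real.log n * (1 - ρ n ^ 2) = 2 * τ * (1 + ρ n) := by rw [hτdef]; ring
    rw [this]
    nlinarith
  have hcw : √(2 * Real.log n * (1 - ρ n ^ 2)) * w ≤ 2 * √τ * |w| :=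
    (mul_le_mul_of_nonneg_left (le_abs_self w) (Real.sqrt_nonneg _)).trans
      (mul_le_mul_of_nonneg_right hc (abs_nonneg w))
  have hsq : 2 * √τ * |w| ≤ τ / 4 + 4 * w ^ 2 := by
    have h1 : √τ ^ 2 = τ := Real.sq_sqrt hτ0.le
    nlinarith [sq_nonneg (√τ / 2 - 2 * |w|), sq_abs w]
  have hz : ρ n * z ≤ |z| := (le_abs_self _).trans (by
    rw [abs_mul]; exact mul_le_of_le_one_left (abs_nonneg _) hr)
  have hk : τ ≤ (1 - ρ n) * levelShift n :=
    mul_le_mul_of_nonneg_left hsh.le (by linarith)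
  linarith [neg_abs_le y, sq_nonneg w]

/-- Now `ρ → 1`, the noise coefficient tends to `2l` and the drift to `2l²`. The scaled difference
has the limit `2lw + z - y - 2l²`, whose sign decides; `hne` excludes the value `0`. -/
lemma eventually_conditional_lt_iff {ρ : ℕ → ℝ} {l : ℝ} (hl : 0 ≤ l)
    (h : Tendsto (fun n : ℕ => (1 - ρ n) * Real.log n) atTop (𝓝 (l ^ 2))) {z w y : ℝ}
    (hne : 2 * l * w ≠ y - z + 2 * l ^ 2) :
    ∀ᶠ n in atTop, (ρ n * normLevel n z + √(1 - ρ n ^ 2) * w < normLevel n y ↔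
      2 * l * w ≤ y - z + 2 * l ^ 2) := by
  have hρ1 : Tendsto ρ atTop (𝓝 1) := by
    have h1 := h.div_atTop tendsto_log_natCast
    have h2 := h1.const_sub 1
    rw [sub_zero] at h2
    refine h2.congr' ?_
    filter_upwards [eventually_ge_atTop 2] with n hn
    have hL := log_natCast_pos hn
    field_simp; ring
  have hk : Tendsto (fun n : ℕ => (1 - ρ n) * levelShift n) atTop (𝓝 (2 * l ^ 2)) := by
    have h1 := h.mul tendsto_levelShift_div_log
    rw [mul_comm] at h1
    refine h1.congr' ?_
    filter_upwards [eventually_ge_atTop 2] with n hn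
    have hL := log_natCast_pos hn
    field_simp
  have hc : Tendsto (fun n : ℕ => √(2 * Real.log n * (1 - ρ n ^ 2))) atTop (𝓝 (2 * l)) := by
    have h1 : Tendsto (fun n : ℕ => 2 * ((1 - ρ n) * Real.log n) * (1 + ρ n)) atTop
        (𝓝 (2 * l ^ 2 * (1 + 1))) := (h.const_mul 2).mul (hρ1.const_add 1)
    have h2 := (Real.continuous_sqrt.tendsto _).comp h1
    rw [show 2 * l ^ 2 * (1 + 1) = (2 * l) ^ 2 by ring, Real.sqrt_sq (by positivity)] at h2
    refine h2.congr fun n => ?_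
    simp only [Function.comp]
    congr 1; ring
  have hD := (((hc.mul_const w).add (hρ1.mul_const z)).sub_const y).sub hk
  rcases lt_or_gt_of_ne hne with hlt | hlt
  · filter_upwards [hD.eventually_lt_const (show 2 * l * w + 1 * z - y - 2 * l ^ 2 < 0 by linarith),
      eventually_ge_atTop 2] with n h1 hn
    rw [conditional_lt_iff hn]
    exact ⟨fun _ => hlt.le, fun _ => h1⟩
  · filter_upwards [hD.eventually_const_lt (show 0 < 2 * l * w + 1 * z - y - 2 * l ^ 2 by linarith),
      eventually_ge_atTop 2] with n h1 hn
    rw [conditional_lt_iff hn]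
    exact ⟨fun h => absurd h (not_lt.2 h1.le), fun h => absurd h (not_le.2 hlt)⟩

lemma HuslerReissCondition.tendsto_atTop {ρ : ℕ → ℝ} (h : HuslerReissCondition ρ ⊤) :
    Tendsto (fun n : ℕ => (1 - ρ n) * Real.log n) atTop atTop := by
  rw [HuslerReissCondition, ENNReal.top_pow two_ne_zero] at h
  exact ENNReal.tendsto_ofReal_nhds_top.1 h

lemma HuslerReissCondition.tendsto_nhds {ρ : ℕ → ℝ} {lam : ℝ≥0∞} (h : HuslerReissCondition ρ lam)
    (hρ : ∀ᶠ n in atTop, |ρ n| ≤ 1) (hlam : lam ≠ ⊤) :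
    Tendsto (fun n : ℕ => (1 - ρ n) * Real.log n) atTop (𝓝 (lam.toReal ^ 2)) := by
  have h1 := (ENNReal.tendsto_toReal (ENNReal.pow_ne_top hlam (n := 2))).comp h
  rw [ENNReal.toReal_pow] at h1
  refine h1.congr' ?_
  filter_upwards [hρ] with n hn
  simp only [Function.comp]
  refine ENNReal.toReal_ofReal (mul_nonneg ?_ (Real.log_natCast_nonneg n))
  linarith [(abs_le.1 hn).2]

lemma ae_ne_gaussianReal (c : ℝ) : ∀ᵐ w ∂(gaussianReal 0 1), w ≠ c := by
  have := nullSingletonClass_gaussianReal (μ := 0) (v := 1) one_ne_zero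
  exact Measure.ae_ne _ c

/-- The undecided boundary is null: for `λ = 0` it is the point `z = y`, for `0 < λ < ∞` a single
`w` for each `z`. -/
lemma HuslerReissCondition.ae_eventually_iff {ρ : ℕ → ℝ} {lam : ℝ≥0∞}
    (h : HuslerReissCondition ρ lam) (hρ : ∀ᶠ n in atTop, |ρ n| ≤ 1) (y : ℝ) :
    ∀ᵐ z : ℝ, ∀ᵐ w ∂(gaussianReal 0 1), ∀ᶠ n in atTop,
      (ρ n * normLevel n z + √(1 - ρ n ^ 2) * w < normLevel n y ↔
        (lam = ⊤ ∨ 2 * lam.toReal * w ≤ y - z + 2 * lam.toReal ^ 2)) := by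
  by_cases hlam : lam = ⊤
  · subst hlam
    refine ae_of_all _ fun z => ae_of_all _ fun w => ?_
    filter_upwards [eventually_conditional_lt hρ h.tendsto_atTop z w y] with n hn
    simp [hn]
  have h' := h.tendsto_nhds hρ hlam
  simp only [hlam, false_or]
  filter_upwards [Measure.ae_ne volume y] with z hz
  by_cases h0 : lam.toReal = 0
  · refine ae_of_all _ fun w => eventually_conditional_lt_iff ENNReal.toReal_nonneg h' ?_
    rw [h0]
    intro h1
    apply hz
    linarith
  · filter_upwards [ae_ne_gaussianReal ((y - z + 2 * lam.toReal ^ 2) / (2 * lam.toReal))] with w hw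
    refine eventually_conditional_lt_iff ENNReal.toReal_nonneg h' fun h1 => hw ?_
    rw [← h1]; field_simp

lemma bivLaw_real (r : ℝ) {S : Set (ℝ × ℝ)} (hS : MeasurableSet S) :
    (bivLaw r).real S = ((gaussianReal 0 1).prod (gaussianReal 0 1)).real
      {p | (p.1, r * p.1 + √(1 - r ^ 2) * p.2) ∈ S} := by
  rw [bivLaw, map_measureReal_apply (measurable_bivMap r) hS]; rfl

lemma bivLaw_real_swap {r : ℝ} (hr : |r| ≤ 1) {S : Set (ℝ × ℝ)} (hS : MeasurableSet S) :
    (bivLaw r).real {p | p.swap ∈ S} = (bivLaw r).real S := by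
  conv_rhs => rw [← bivLaw_map_swap hr, map_measureReal_apply measurable_swap hS]
  rfl

lemma bivLaw_real_neg {r : ℝ} (hr : |r| ≤ 1) {S : Set (ℝ × ℝ)} (hS : MeasurableSet S) :
    (bivLaw r).real {p | -p ∈ S} = (bivLaw r).real S := by
  conv_rhs => rw [← bivLaw_map_neg hr, map_measureReal_apply measurable_neg hS]
  rfl

/-- `S n` is only required to lie between the open and the closed half-plane, since maxima lead to
strict and minima to non-strict inequalities. -/
lemma tendsto_natCast_mul_bivLaw_fst (ρ : ℕ → ℝ) {x : ℝ} {S : ℕ → Set (ℝ × ℝ)}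
    (hS : ∀ n, MeasurableSet (S n)) (h1 : ∀ n, ∀ p ∈ S n, normLevel n x ≤ p.1)
    (h2 : ∀ n, ∀ p : ℝ × ℝ, normLevel n x < p.1 → p ∈ S n) :
    Tendsto (fun n : ℕ => n * (bivLaw (ρ n)).real (S n)) atTop (𝓝 (Real.exp (-x))) := by
  have := tendsto_natCast_mul_real_prod_gaussian (x := x) (B := fun _ => Set.univ)
    (A := fun n => {p | (p.1, ρ n * p.1 + √(1 - ρ n ^ 2) * p.2) ∈ S n})
    (fun n => measurable_bivMap (ρ n) (hS n)) (fun n p hp => h1 n (p.1, ρ n * p.1 + √(1 - ρ n ^ 2) * p.2) hp)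
    (fun _ => MeasurableSet.univ) (by
      filter_upwards [ae_restrict_mem measurableSet_Ioi] with z hz
      refine ae_of_all _ fun w => ?_
      filter_upwards [eventually_ge_atTop 2] with n hn
      simp only [Set.mem_univ, iff_true]
      exact h2 n _ (normLevel_strictMono hn hz))
  simp only [probReal_univ, mul_one, integral_exp_neg_Ioi] at this
  refine this.congr fun n => ?_
  rw [bivLaw_real _ (hS n)]

/-- The part with second coordinate at least `u_n(y)` is a marginal tail after exchanging
coordinates. On the rest the first coordinate is at least `u_n(x)`, and conditioning on it gives
`tailLimit`. -/
lemma HuslerReissCondition.tendsto_natCast_mul_bivLaw_union {ρ : ℕ → ℝ} {lam : ℝ≥0∞}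
    (h : HuslerReissCondition ρ lam) (hρ : ∀ᶠ n in atTop, |ρ n| ≤ 1) {x y : ℝ}
    {S : ℕ → Set (ℝ × ℝ)} (hS : ∀ n, MeasurableSet (S n))
    (h1 : ∀ n, ∀ p ∈ S n, normLevel n x ≤ p.1 ∨ normLevel n y ≤ p.2)
    (h2 : ∀ n, ∀ p : ℝ × ℝ, normLevel n x < p.1 ∨ normLevel n y < p.2 → p ∈ S n) :
    Tendsto (fun n : ℕ => n * (bivLaw (ρ n)).real (S n)) atTop
      (𝓝 (Real.exp (-y) + tailLimit lam x y)) := by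
  have hm : ∀ n, MeasurableSet {p : ℝ × ℝ | p.2 < normLevel n y} := fun n =>
    measurableSet_lt measurable_snd measurable_const
  have hU : ∀ n, MeasurableSet (S n ∩ {p : ℝ × ℝ | p.2 < normLevel n y}ᶜ) := fun n =>
    (hS n).inter (hm n).compl
  have hV : ∀ n, MeasurableSet (S n ∩ {p : ℝ × ℝ | p.2 < normLevel n y}) := fun n =>
    (hS n).inter (hm n)
  have t1 : Tendsto (fun n : ℕ => n * (bivLaw (ρ n)).real
      (S n ∩ {p : ℝ × ℝ | p.2 < normLevel n y}ᶜ)) atTop (𝓝 (Real.exp (-y))) := by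
    refine (tendsto_natCast_mul_bivLaw_fst ρ
      (S := fun n => {p | p.swap ∈ S n ∩ {p : ℝ × ℝ | p.2 < normLevel n y}ᶜ})
      (fun n => measurable_swap (hU n)) ?_ ?_).congr' ?_
    · rintro n p ⟨-, hp⟩
      exact not_lt.1 hp
    · intro n p hp
      exact ⟨h2 n _ (Or.inr hp), not_lt.2 (le_of_lt hp)⟩
    · filter_upwards [hρ] with n hn
      rw [bivLaw_real_swap hn (hU n)]
  have t2 : Tendsto (fun n : ℕ => n * (bivLaw (ρ n)).real
      (S n ∩ {p : ℝ × ℝ | p.2 < normLevel n y})) atTop (𝓝 (tailLimit lam x y)) := by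
    refine (tendsto_natCast_mul_real_prod_gaussian (x := x)
      (B := fun z => {w | lam = ⊤ ∨ 2 * lam.toReal * w ≤ y - z + 2 * lam.toReal ^ 2})
      (A := fun n => {p | (p.1, ρ n * p.1 + √(1 - ρ n ^ 2) * p.2) ∈
        S n ∩ {p : ℝ × ℝ | p.2 < normLevel n y}})
      (fun n => measurable_bivMap (ρ n) (hV n)) ?_ ?_ ?_).congr fun n => ?_
    · rintro n p ⟨hp1, hp2⟩
      exact (h1 n _ hp1).resolve_right (not_le.2 hp2)
    · intro z
      by_cases hlam : lam = ⊤
      · simp [hlam]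
      · simp only [hlam, false_or]
        exact measurableSet_le (by fun_prop) measurable_const
    · filter_upwards [ae_restrict_mem measurableSet_Ioi,
        ae_restrict_of_ae (h.ae_eventually_iff hρ y)] with z hz hae
      filter_upwards [hae] with w hw
      filter_upwards [hw, eventually_ge_atTop 2] with n hn hn2
      refine Iff.trans ?_ hn
      exact ⟨fun hp => hp.2, fun hp => ⟨h2 n _ (Or.inl (normLevel_strictMono hn2 hz)), hp⟩⟩
    · rw [bivLaw_real _ (hV n)]
  refine (t1.add t2).congr fun n => ?_
  rw [← mul_add, add_comm, ← Set.sdiff_eq, measureReal_inter_add_sdiff (hm n)]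

/-- Negating the second component turns the correlation into `-ρ`, and `1 - (-ρ) = 1 + ρ`. Given `ξ₁
= u_n(z)`, eventually `-ξ₂ < u_n(y)`, so the limiting sections are empty. -/
lemma tendsto_natCast_mul_bivLaw_opposite {ρ : ℕ → ℝ} (hρ : ∀ᶠ n in atTop, |ρ n| ≤ 1)
    (h : Tendsto (fun n : ℕ => (1 + ρ n) * Real.log n) atTop atTop) (x y : ℝ) :
    Tendsto (fun n : ℕ => n * (bivLaw (ρ n)).real
      {p | normLevel n x ≤ p.1 ∧ p.2 ≤ -normLevel n y}) atTop (𝓝 0) := by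
  have hm : ∀ n, MeasurableSet {p : ℝ × ℝ | normLevel n x ≤ p.1 ∧ p.2 ≤ -normLevel n y} := fun n =>
    (measurableSet_le measurable_const measurable_fst).inter
      (measurableSet_le measurable_snd measurable_const)
  have := tendsto_natCast_mul_real_prod_gaussian (x := x) (B := fun _ => ∅)
    (A := fun n => {p | (p.1, ρ n * p.1 + √(1 - ρ n ^ 2) * p.2) ∈
      {p : ℝ × ℝ | normLevel n x ≤ p.1 ∧ p.2 ≤ -normLevel n y}})
    (fun n => measurable_bivMap (ρ n) (hm n)) (fun n p hp => hp.1)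
    (fun _ => MeasurableSet.empty) (by
      refine ae_of_all _ fun z => ae_of_all _ fun w => ?_
      have hlt := eventually_conditional_lt (ρ := fun n => -ρ n) (by simpa using hρ)
        (by simpa using h) z (-w) y
      filter_upwards [hlt] with n hn
      simp only [Set.mem_empty_iff_false, iff_false]
      rintro ⟨-, h2⟩
      simp only [neg_sq] at hn
      linarith)
  simp only [measureReal_empty, mul_zero, integral_zero] at this
  refine this.congr fun n => ?_
  rw [bivLaw_real _ (hm n)]

end BivariateTails

/-! ### The limit for independent pairs -/

section IndependentBlocks

lemma tendsto_levelShift_atTop : Tendsto levelShift atTop atTop := by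
  have h := tendsto_levelShift_div_log.pos_mul_atTop (by norm_num) tendsto_log_natCast
  refine h.congr' ?_
  filter_upwards [eventually_ge_atTop 2] with n hn
  have := log_natCast_pos hn
  field_simp

lemma eventually_neg_normLevel_lt (x y : ℝ) : ∀ᶠ n in atTop, -normLevel n y < normLevel n x := by
  filter_upwards [eventually_ge_atTop 2,
    tendsto_levelShift_atTop.eventually_gt_atTop ((-x - y) / 2)] with n hn h
  have hs := sqrt_two_log_pos hn
  have : 0 < √(2 * Real.log n) * (normLevel n x + normLevel n y) := by
    rw [mul_add, sqrt_mul_normLevel hn, sqrt_mul_normLevel hn]; linarith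
  linarith [(pos_iff_pos_of_mul_pos this).1 hs]

lemma HuslerReissCondition.tendsto_one_add_atTop {ρ : ℕ → ℝ} {lam : ℝ≥0∞}
    (h : HuslerReissCondition ρ lam) (hρ : ∀ᶠ n in atTop, |ρ n| ≤ 1)
    (hneg : lam = ⊤ → Tendsto (fun n : ℕ => (1 + ρ n) * Real.log n) atTop atTop) :
    Tendsto (fun n : ℕ => (1 + ρ n) * Real.log n) atTop atTop := by
  by_cases hlam : lam = ⊤
  · exact hneg hlam
  have h1 := (tendsto_log_natCast.const_mul_atTop (show (0:ℝ) < 2 by norm_num)).atTop_add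
    (h.tendsto_nhds hρ hlam).neg
  refine h1.congr fun n => ?_
  ring

lemma HuslerReissCondition.tendsto_bivLaw_rect_pow {ρ : ℕ → ℝ} {lam : ℝ≥0∞}
    (h : HuslerReissCondition ρ lam) (hρ : ∀ᶠ n in atTop, |ρ n| ≤ 1)
    (hplus : Tendsto (fun n : ℕ => (1 + ρ n) * Real.log n) atTop atTop) (x₁ x₂ y₁ y₂ : ℝ) :
    Tendsto (fun n : ℕ => (bivLaw (ρ n)).real
      (Set.Ioc (-normLevel n y₁) (normLevel n x₁) ×ˢ
        Set.Ioc (-normLevel n y₂) (normLevel n x₂)) ^ n) atTop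
      (𝓝 (huslerReissCDF lam x₁ x₂ * huslerReissCDF lam y₁ y₂)) := by
  set Sp : ℕ → Set (ℝ × ℝ) := fun n => {p | normLevel n x₁ < p.1 ∨ normLevel n x₂ < p.2} with hSp
  set Sm : ℕ → Set (ℝ × ℝ) := fun n => {p | normLevel n y₁ ≤ p.1 ∨ normLevel n y₂ ≤ p.2} with hSm
  have mSp : ∀ n, MeasurableSet (Sp n) := fun n =>
    (measurableSet_lt measurable_const measurable_fst).union
      (measurableSet_lt measurable_const measurable_snd)
  have mSm : ∀ n, MeasurableSet (Sm n) := fun n =>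
    (measurableSet_le measurable_const measurable_fst).union
      (measurableSet_le measurable_const measurable_snd)
  have mSm' : ∀ n, MeasurableSet {p : ℝ × ℝ | -p ∈ Sm n} := fun n => measurable_neg (mSm n)
  have tp := h.tendsto_natCast_mul_bivLaw_union hρ (x := x₁) (y := x₂) mSp
    (fun n p hp => hp.imp le_of_lt le_of_lt) (fun n p hp => hp)
  have tm := h.tendsto_natCast_mul_bivLaw_union hρ (x := y₁) (y := y₂) mSm
    (fun n p hp => hp) (fun n p hp => hp.imp le_of_lt le_of_lt)
  have mO : ∀ x y n, MeasurableSet {p : ℝ × ℝ | normLevel n x ≤ p.1 ∧ p.2 ≤ -normLevel n y} :=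
    fun x y n => (measurableSet_le measurable_const measurable_fst).inter
      (measurableSet_le measurable_snd measurable_const)
  -- Of the four combinations, those in a single coordinate are impossible once `-u_n(y) < u_n(x)`;
  -- the mixed ones need extremes of opposite sign.
  have tI : Tendsto (fun n : ℕ => n * (bivLaw (ρ n)).real (Sp n ∩ {p | -p ∈ Sm n})) atTop (𝓝 0) := by
    have o1 := tendsto_natCast_mul_bivLaw_opposite hρ hplus x₁ y₂
    have o2 := tendsto_natCast_mul_bivLaw_opposite hρ hplus x₂ y₁
    have o3 := o1.add o2
    rw [add_zero] at o3
    refine tendsto_of_tendsto_of_tendsto_of_le_of_le' tendsto_const_nhds o3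
      (Eventually.of_forall fun n => by positivity) ?_
    filter_upwards [hρ, eventually_neg_normLevel_lt x₁ y₁, eventually_neg_normLevel_lt x₂ y₂]
      with n hn e1 e2
    rw [← mul_add, ← bivLaw_real_swap hn (mO x₂ y₁ n)]
    refine mul_le_mul_of_nonneg_left ((measureReal_mono ?_).trans (measureReal_union_le _ _))
      (by positivity)
    rintro ⟨a, b⟩ ⟨hp, hm⟩
    simp only [hSp, hSm, Set.mem_ofPred_eq, Prod.neg_mk] at hp hm
    rcases hp with hp | hp <;> rcases hm with hm | hm
    · exact absurd hp (by linarith)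
    · exact Or.inl ⟨hp.le, by simp only; linarith⟩
    · exact Or.inr ⟨hp.le, by simp only [Prod.snd_swap]; linarith⟩
    · exact absurd hp (by linarith)
  have hlim := ((tp.add tm).sub tI).neg
  -- With `n g_n → c`, `(1 + g_n)^n → e^c`; here `-g_n` is the probability of leaving the rectangle,
  -- found by inclusion and exclusion.
  have key := Real.tendsto_one_add_pow_exp_of_tendsto (g := fun n => (bivLaw (ρ n)).real
      (Set.Ioc (-normLevel n y₁) (normLevel n x₁) ×ˢ
        Set.Ioc (-normLevel n y₂) (normLevel n x₂)) - 1) (hlim.congr' ?_)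
  · rw [huslerReissCDF_eq_exp, huslerReissCDF_eq_exp, ← Real.exp_add]
    convert key using 2
    · simp only [add_sub_cancel]
    · congr 1; ring
  filter_upwards [hρ] with n hn
  have hc : (Set.Ioc (-normLevel n y₁) (normLevel n x₁) ×ˢ
        Set.Ioc (-normLevel n y₂) (normLevel n x₂)) = (Sp n ∪ {p | -p ∈ Sm n})ᶜ := by
    ext ⟨a, b⟩
    simp only [hSp, hSm, Set.mem_prod, Set.mem_Ioc, Set.mem_compl_iff, Set.mem_union,
      Set.mem_ofPred_eq, Prod.neg_mk, not_or, not_lt, not_le]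
    constructor
    · rintro ⟨⟨h1, h2⟩, h3, h4⟩
      exact ⟨⟨h2, h4⟩, by linarith, by linarith⟩
    · rintro ⟨⟨h1, h2⟩, h3, h4⟩
      exact ⟨⟨by linarith, h1⟩, by linarith, h2⟩
  rw [hc, probReal_compl_eq_one_sub ((mSp n).union (mSm' n)), ← bivLaw_real_neg hn (mSm n)]
  have := measureReal_union_add_inter (μ := bivLaw (ρ n)) (s := Sp n) (mSm' n)
  linear_combination (n : ℝ) * this

end IndependentBlocks

/-! ### The Berman sum -/

section BermanSum

lemma two_mul_log_add_le_normLevel_sq {n : ℕ} (hn : 2 ≤ n) (z : ℝ) :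
    2 * Real.log n + 2 * (z - 1 / 2 * Real.log (4 * Real.pi * Real.log n)) ≤ normLevel n z ^ 2 := by
  have hL := log_natCast_pos hn
  rw [normLevel_sq hn]
  have : 0 ≤ (z - 1 / 2 * Real.log (4 * Real.pi * Real.log n)) ^ 2 / (2 * Real.log n) := by
    positivity
  linarith

/-- Up to powers of `ln n` the expression is `n` to the power `1 + α - 2 / (1 + σ)`, which is
negative exactly when `α < (1 - σ) / (1 + σ)`. -/
lemma tendsto_early_terms {σ α : ℝ} (hσ : 0 ≤ σ) (hα : α < (1 - σ) / (1 + σ)) (z : ℝ) :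
    Tendsto (fun n : ℕ => n * (⌊(n : ℝ) ^ α⌋₊ * Real.exp (-normLevel n z ^ 2 / (1 + σ)))) atTop
      (𝓝 0) := by
  have hs : 0 < 1 + σ := by linarith
  have hbr : Tendsto (fun n : ℕ => (1 + α) - 2 / (1 + σ) +
      (Real.log (4 * Real.pi * Real.log n) / Real.log n) / (1 + σ) -
      (2 * z / (1 + σ)) / Real.log n) atTop
      (𝓝 ((1 + α) - 2 / (1 + σ) + 0 / (1 + σ) - 0)) :=
    ((tendsto_loglog_div_log'.div_const _).const_add _).sub
      (tendsto_const_nhds.div_atTop tendsto_log_natCast)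
  have hneg : (1 + α) - 2 / (1 + σ) + 0 / (1 + σ) - 0 < 0 := by
    have : (1 - σ) / (1 + σ) = 2 / (1 + σ) - 1 := by field_simp; ring
    rw [this] at hα
    simp only [zero_div]; linarith
  have hlim := Real.tendsto_exp_atBot.comp (tendsto_log_natCast.atTop_mul_neg hneg hbr)
  refine tendsto_of_tendsto_of_tendsto_of_le_of_le' tendsto_const_nhds hlim
    (Eventually.of_forall fun n => by positivity) ?_
  filter_upwards [eventually_ge_atTop 2] with n hn
  have hL := log_natCast_pos hn
  have hn0 : (0:ℝ) < n := by positivity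
  have h1 : (⌊(n : ℝ) ^ α⌋₊ : ℝ) ≤ Real.exp (Real.log n * α) := by
    rw [← Real.rpow_def_of_pos hn0]
    exact Nat.floor_le (by positivity)
  have h2 : Real.exp (-normLevel n z ^ 2 / (1 + σ)) ≤
      Real.exp (-(2 * Real.log n + 2 * (z - 1 / 2 * Real.log (4 * Real.pi * Real.log n))) /
        (1 + σ)) := by
    rw [Real.exp_le_exp]
    gcongr
    exact two_mul_log_add_le_normLevel_sq hn z
  calc (n:ℝ) * (⌊(n : ℝ) ^ α⌋₊ * Real.exp (-normLevel n z ^ 2 / (1 + σ)))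
      ≤ Real.exp (Real.log n) * (Real.exp (Real.log n * α) *
        Real.exp (-(2 * Real.log n + 2 * (z - 1 / 2 * Real.log (4 * Real.pi * Real.log n))) /
        (1 + σ))) := by
        rw [Real.exp_log hn0]; gcongr
    _ = _ := by
        rw [← Real.exp_add, ← Real.exp_add]
        simp only [Function.comp]
        congr 1
        field_simp
        ring

/-- `n² exp (-u_n(z)²)` is at most of order `ln n`, and the denominator `1 + δ n` costs a factor of
at most `exp (2 δ n ln n) → 1`. What remains is a multiple of `δ n ln n`. -/
lemma tendsto_late_terms {δ : ℕ → ℝ} (hδ : ∀ n, 0 ≤ δ n)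
    (h : Tendsto (fun n : ℕ => δ n * Real.log n) atTop (𝓝 0)) (z : ℝ) :
    Tendsto (fun n : ℕ => (n : ℝ) ^ 2 * (δ n * Real.exp (-normLevel n z ^ 2 / (1 + δ n)))) atTop
      (𝓝 0) := by
  have hexp : Tendsto (fun n : ℕ => Real.exp (2 * (δ n * Real.log n))) atTop (𝓝 1) := by
    have := (Real.continuous_exp.tendsto _).comp (h.const_mul 2)
    simpa [Function.comp_def] using this
  have hlim := (h.mul hexp).mul_const (4 * Real.pi * Real.exp (-(2 * z)))
  rw [zero_mul, zero_mul] at hlim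
  have hll : Tendsto (fun n : ℕ => Real.log (4 * Real.pi * Real.log n)) atTop atTop :=
    Real.tendsto_log_atTop.comp (tendsto_log_natCast.const_mul_atTop (by positivity))
  refine tendsto_of_tendsto_of_tendsto_of_le_of_le' tendsto_const_nhds hlim
    (Eventually.of_forall fun n => by have := hδ n; positivity) ?_
  filter_upwards [eventually_ge_atTop 2, hll.eventually_ge_atTop (2 * z)] with n hn hz
  have hL := log_natCast_pos hn
  have hn0 : (0:ℝ) < n := by positivity
  have hd := hδ n
  set q := z - 1 / 2 * Real.log (4 * Real.pi * Real.log n) with hq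
  -- The sign of `q` guarantees `-2q / (1 + δ n) ≤ -2q`.
  have hq0 : q ≤ 0 := by rw [hq]; linarith
  have h1 : (n:ℝ) ^ 2 * Real.exp (-normLevel n z ^ 2 / (1 + δ n)) ≤
      Real.exp (2 * (δ n * Real.log n)) * (Real.log n * (4 * Real.pi * Real.exp (-(2 * z)))) := by
    have e1 : (n:ℝ) ^ 2 = Real.exp (2 * Real.log n) := by
      rw [mul_comm, Real.exp_mul, Real.exp_log hn0]; norm_num
    have e2 : Real.log n * (4 * Real.pi * Real.exp (-(2 * z))) = Real.exp (-(2 * q)) := by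
      rw [hq, show -(2 * (z - 1 / 2 * Real.log (4 * Real.pi * Real.log n))) =
        Real.log (4 * Real.pi * Real.log n) + -(2 * z) by ring, Real.exp_add,
        Real.exp_log (by positivity)]
      ring
    rw [e1, e2, ← Real.exp_add, ← Real.exp_add, Real.exp_le_exp]
    have h2 : -normLevel n z ^ 2 / (1 + δ n) ≤ -(2 * Real.log n + 2 * q) / (1 + δ n) := by
      gcongr
      exact two_mul_log_add_le_normLevel_sq hn z
    have h3 : -(2 * Real.log n + 2 * q) / (1 + δ n) ≤
        2 * (δ n * Real.log n) + -(2 * q) - 2 * Real.log n := by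
      rw [div_le_iff₀ (by positivity)]
      nlinarith [mul_nonneg (mul_nonneg hd hd) hL.le, mul_nonneg hd (neg_nonneg.2 hq0)]
    linarith
  calc (n : ℝ) ^ 2 * (δ n * Real.exp (-normLevel n z ^ 2 / (1 + δ n)))
      = δ n * ((n : ℝ) ^ 2 * Real.exp (-normLevel n z ^ 2 / (1 + δ n))) := by ring
    _ ≤ δ n * _ := mul_le_mul_of_nonneg_left h1 hd
    _ = _ := by ring

/-- At most `2m - 1` indices are closer to `k` than `m`, each with two components. -/
lemma card_filter_natAbs_lt (n m : ℕ) (k : Fin n) :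
    (Finset.univ.filter fun q : Fin n × Fin 2 =>
      (((k : ℕ) : ℤ) - ((q.1 : ℕ) : ℤ)).natAbs < m).card ≤ 4 * m := by
  have h1 : (Finset.univ.filter fun q : Fin n × Fin 2 =>
      (((k : ℕ) : ℤ) - ((q.1 : ℕ) : ℤ)).natAbs < m).card ≤
      (Finset.Ioo ((k : ℕ) - m : ℤ) ((k : ℕ) + m) ×ˢ (Finset.univ : Finset (Fin 2))).card := by
    refine Finset.card_le_card_of_injOn (fun q => (((q.1 : ℕ) : ℤ), q.2)) ?_ ?_
    · intro q hq
      simp only [Finset.coe_filter, Finset.mem_univ, true_and, Set.mem_ofPred_eq] at hq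
      simp only [Finset.coe_product, Set.mem_prod, Finset.mem_coe, Finset.mem_Ioo, Finset.mem_univ,
        and_true]
      omega
    · rintro ⟨a, i⟩ - ⟨b, j⟩ - hab
      simp only [Prod.mk.injEq, Nat.cast_inj] at hab
      exact Prod.ext (Fin.ext hab.1) hab.2
  refine h1.trans ?_
  rw [Finset.card_product, Int.card_Ioo, Finset.card_univ, Fintype.card_fin]
  omega

/-- Monotonicity in the correlation lets each term be evaluated at `σ` or at the largest late
correlation. -/
lemma abs_mul_exp_le {w a b : ℝ} (ha : 0 ≤ a) (hab : a ≤ b) :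
    a * Real.exp (-w ^ 2 / (1 + a)) ≤ b * Real.exp (-w ^ 2 / (1 + b)) := by
  have : Real.exp (-w ^ 2 / (1 + a)) ≤ Real.exp (-w ^ 2 / (1 + b)) := by
    rw [Real.exp_le_exp, neg_div, neg_div, neg_le_neg_iff]
    gcongr
  have hb := ha.trans hab
  gcongr

lemma abs_le_maxLateCorr (ρ : Fin 2 → Fin 2 → ℕ → ℕ → ℝ) {α : ℝ} {n k : ℕ} (i j : Fin 2)
    (hk : ⌊(n : ℝ) ^ α⌋₊ ≤ k) (hkn : k < n) : |ρ i j k n| ≤ maxLateCorr ρ α n := by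
  have h1 : ‖ρ i j k n‖₊ ≤ maxLateCorr ρ α n :=
    (Finset.le_sup (f := fun p : Fin 2 × Fin 2 => ‖ρ p.1 p.2 k n‖₊) (Finset.mem_univ (i, j))).trans
      (Finset.le_sup (f := fun k => Finset.univ.sup fun p : Fin 2 × Fin 2 => ‖ρ p.1 p.2 k n‖₊)
        (Finset.mem_Ico.2 ⟨hk, hkn⟩))
  exact_mod_cast h1

/-- The sum in the normal comparison lemma, for a stationary array and blocks of length one. -/
lemma sum_abs_mul_exp_le {n : ℕ} {ρ : Fin 2 → Fin 2 → ℕ → ℕ → ℝ} {σ α w : ℝ}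
    (hρσ : ∀ k i j, 1 ≤ k → k < n → |ρ i j k n| ≤ σ) (hσ : σ ≤ 1)
    {D : Fin n × Fin 2 → Fin n × Fin 2 → ℝ} (hD0 : ∀ p q, p.1 = q.1 → D p q = 0)
    (hD : ∀ p q, p.1 ≠ q.1 →
      D p q = ρ p.2 q.2 (((p.1 : ℕ) : ℤ) - ((q.1 : ℕ) : ℤ)).natAbs n) :
    ∑ p, ∑ q, |D p q| * Real.exp (-w ^ 2 / (1 + |D p q|)) ≤
      8 * (n * (⌊(n : ℝ) ^ α⌋₊ * Real.exp (-w ^ 2 / (1 + σ)))) +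
      4 * (n ^ 2 * (maxLateCorr ρ α n * Real.exp (-w ^ 2 / (1 + maxLateCorr ρ α n)))) := by
  set m := ⌊(n : ℝ) ^ α⌋₊ with hm
  set δ : ℝ := ((maxLateCorr ρ α n : ℝ≥0) : ℝ) with hδ
  have hδ0 : 0 ≤ δ := NNReal.coe_nonneg _
  -- For short lags the prefactor is dropped using `σ ≤ 1`. The late bound is added in every case,
  -- so that summing over `q` is mere counting.
  have hterm : ∀ p q, |D p q| * Real.exp (-w ^ 2 / (1 + |D p q|)) ≤
      (if (((p.1 : ℕ) : ℤ) - ((q.1 : ℕ) : ℤ)).natAbs < m then Real.exp (-w ^ 2 / (1 + σ)) else 0) +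
        δ * Real.exp (-w ^ 2 / (1 + δ)) := by
    intro p q
    have hnn : 0 ≤ δ * Real.exp (-w ^ 2 / (1 + δ)) := by positivity
    by_cases hpq : p.1 = q.1
    · rw [hD0 p q hpq]
      simp only [abs_zero, zero_mul]
      split_ifs <;> positivity
    have hne : (p.1 : ℕ) ≠ (q.1 : ℕ) := fun h => hpq (Fin.ext h)
    have hp := p.1.isLt
    have hq := q.1.isLt
    have hlag1 : 1 ≤ (((p.1 : ℕ) : ℤ) - ((q.1 : ℕ) : ℤ)).natAbs := by omega
    have hlag2 : (((p.1 : ℕ) : ℤ) - ((q.1 : ℕ) : ℤ)).natAbs < n := by omega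
    rw [hD p q hpq]
    split_ifs with hlt
    · refine (abs_mul_exp_le (abs_nonneg _) (hρσ _ _ _ hlag1 hlag2)).trans ?_
      have : σ * Real.exp (-w ^ 2 / (1 + σ)) ≤ Real.exp (-w ^ 2 / (1 + σ)) :=
        mul_le_of_le_one_left (Real.exp_pos _).le hσ
      linarith
    · rw [zero_add]
      exact abs_mul_exp_le (abs_nonneg _) (abs_le_maxLateCorr ρ _ _ (not_lt.1 hlt) hlag2)
  have hrow : ∀ p : Fin n × Fin 2, ∑ q, |D p q| * Real.exp (-w ^ 2 / (1 + |D p q|)) ≤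
      4 * m * Real.exp (-w ^ 2 / (1 + σ)) + 2 * n * (δ * Real.exp (-w ^ 2 / (1 + δ))) := by
    intro p
    refine (Finset.sum_le_sum fun q _ => hterm p q).trans ?_
    rw [Finset.sum_add_distrib, ← Finset.sum_filter, Finset.sum_const, Finset.sum_const,
      Finset.card_univ, Fintype.card_prod, Fintype.card_fin, Fintype.card_fin, nsmul_eq_mul,
      nsmul_eq_mul]
    have hc : ((Finset.univ.filter fun q : Fin n × Fin 2 =>
      (((p.1 : ℕ) : ℤ) - ((q.1 : ℕ) : ℤ)).natAbs < m).card : ℝ) ≤ 4 * m := by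
      exact_mod_cast card_filter_natAbs_lt n m p.1
    refine add_le_add (mul_le_mul_of_nonneg_right hc (Real.exp_pos _).le) (le_of_eq ?_)
    push_cast; ring
  refine (Finset.sum_le_sum fun p _ => hrow p).trans (le_of_eq ?_)
  rw [Finset.sum_const, Finset.card_univ, Fintype.card_prod, Fintype.card_fin, Fintype.card_fin,
    nsmul_eq_mul]
  push_cast; ring

end BermanSum

/-! ### Comparison of a row with independent pairs -/

section Array
variable {Ω : Type*} [MeasurableSpace Ω] {P : Measure Ω}
  {X : (n : ℕ) → Fin n → Fin 2 → Ω → ℝ} {ρ₀ : ℕ → ℝ} {ρ : Fin 2 → Fin 2 → ℕ → ℕ → ℝ}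

/-- The event that all normalised extremes of row `n` lie within the bounds `z`. -/
def extremesEvent {Ω : Type*} (X : (n : ℕ) → Fin n → Fin 2 → Ω → ℝ) (n : ℕ)
    (z : (Fin 2 → ℝ) × (Fin 2 → ℝ)) : Set Ω :=
  {ω | ∀ i : Fin 2, -normLevel n (z.2 i) < rowMin X n i ω ∧
    rowMin X n i ω ≤ rowMax X n i ω ∧ rowMax X n i ω ≤ normLevel n (z.1 i)}

/-- For non-empty rows the extremes are attained and correctly ordered, so the event is a box. Row
`0` is excluded: its extremes are default values. -/
lemma mem_extremesEvent {Ω : Type*} {X : (n : ℕ) → Fin n → Fin 2 → Ω → ℝ} {n : ℕ} (hn : n ≠ 0) (z : (Fin 2 → ℝ) × (Fin 2 → ℝ)) (ω : Ω) :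
    ω ∈ extremesEvent X n z ↔ ∀ (k : Fin n) (i : Fin 2),
      X n k i ω ∈ Set.Ioc (-normLevel n (z.2 i)) (normLevel n (z.1 i)) := by
  have : Nonempty (Fin n) := ⟨⟨0, Nat.pos_of_ne_zero hn⟩⟩
  have hb : ∀ i, BddBelow (Set.range fun k : Fin n => X n k i ω) := fun i =>
    (Set.finite_range _).bddBelow
  have ha : ∀ i, BddAbove (Set.range fun k : Fin n => X n k i ω) := fun i =>
    (Set.finite_range _).bddAbove
  simp only [extremesEvent, Set.mem_ofPred_eq, rowMin, rowMax]
  constructor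
  · intro h k i
    obtain ⟨h1, -, h3⟩ := h i
    exact ⟨h1.trans_le (ciInf_le (hb i) k), (le_ciSup (ha i) k).trans h3⟩
  · intro h i
    refine ⟨?_, ?_, ciSup_le fun k => (h k i).2⟩
    · obtain ⟨k, hk⟩ := exists_eq_ciInf_of_finite (f := fun k : Fin n => X n k i ω)
      rw [← hk]; exact (h k i).1
    · obtain ⟨k⟩ := this
      exact (ciInf_le (hb i) k).trans (le_ciSup (ha i) k)

/-- The law of row `n`. -/
noncomputable def rowLaw (P : Measure Ω) (X : (n : ℕ) → Fin n → Fin 2 → Ω → ℝ) (n : ℕ) :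
    Measure (Fin n × Fin 2 → ℝ) := P.map fun ω p => X n p.1 p.2 ω

lemma IsStationaryGaussianArray.isProbabilityMeasure_rowLaw [IsProbabilityMeasure P]
    (hX : IsStationaryGaussianArray P X ρ₀ ρ) (n : ℕ) : IsProbabilityMeasure (rowLaw P X n) :=
  Measure.isProbabilityMeasure_map (hX.gaussian n).aemeasurable

lemma IsStationaryGaussianArray.real_extremesEvent (hX : IsStationaryGaussianArray P X ρ₀ ρ)
    {n : ℕ} (hn : n ≠ 0) (z : (Fin 2 → ℝ) × (Fin 2 → ℝ)) :
    P.real (extremesEvent X n z) = (rowLaw P X n).real (Set.univ.pi fun p : Fin n × Fin 2 =>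
      Set.Ioc (-normLevel n (z.2 p.2)) (normLevel n (z.1 p.2))) := by
  rw [rowLaw, map_measureReal_apply_of_aemeasurable (hX.gaussian n).aemeasurable
    (MeasurableSet.univ_pi fun p => measurableSet_Ioc)]
  congr 1
  ext ω
  rw [mem_extremesEvent hn]
  simp only [Set.mem_preimage, Set.mem_univ_pi, Prod.forall]

lemma IsStationaryGaussianArray.memLp (hX : IsStationaryGaussianArray P X ρ₀ ρ) {n : ℕ}
    (k : Fin n) (i : Fin 2) : MemLp (X n k i) 2 P :=
  (HasGaussianLaw.eval (X := fun (p : Fin n × Fin 2) => X n p.1 p.2) (hX.gaussian n)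
    (k, i)).memLp_two

/-- The sum and the difference of the two components have variances `2 + 2ρ₀ n` and `2 - 2ρ₀ n`,
both non-negative. -/
lemma IsStationaryGaussianArray.abs_corr_le_one [IsProbabilityMeasure P]
    (hX : IsStationaryGaussianArray P X ρ₀ ρ) {n : ℕ}
    (hn : n ≠ 0) : |ρ₀ n| ≤ 1 := by
  set k : Fin n := ⟨0, Nat.pos_of_ne_zero hn⟩
  have h1 := variance_add (hX.memLp k 0) (hX.memLp k 1)
  have h2 := variance_sub (hX.memLp k 0) (hX.memLp k 1)
  rw [hX.unit_variance, hX.unit_variance, hX.corr_same] at h1 h2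
  have h3 := variance_nonneg (X n k 0 + X n k 1) P
  have h4 := variance_nonneg (X n k 0 - X n k 1) P
  rw [abs_le]
  constructor <;> linarith

/-- The comparison matrix keeps the `2 × 2` diagonal blocks and sets the rest to zero. The matrices
therefore differ only at positive lags, where `σ` bounds the entries. -/
lemma IsStationaryGaussianArray.abs_real_sub_pow_le [IsProbabilityMeasure P]
    (hX : IsStationaryGaussianArray P X ρ₀ ρ)
    {C : ℝ} (hC0 : 0 < C)
    (hC : ∀ x, |deriv Real.smoothTransition x| ≤ (Set.Icc (0:ℝ) 1).indicator (fun _ => C) x)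
    {n : ℕ} (hn : 2 ≤ n) {σ α w : ℝ} (hρσ : ∀ k i j, 1 ≤ k → k < n → |ρ i j k n| ≤ σ)
    (hσ : σ < 1) (hw : 0 ≤ w) (z : (Fin 2 → ℝ) × (Fin 2 → ℝ))
    (hz1 : ∀ i, w ≤ normLevel n (z.1 i)) (hz2 : ∀ i, w ≤ normLevel n (z.2 i)) :
    |P.real (extremesEvent X n z) - (bivLaw (ρ₀ n)).real
      (Set.Ioc (-normLevel n (z.2 0)) (normLevel n (z.1 0)) ×ˢ
        Set.Ioc (-normLevel n (z.2 1)) (normLevel n (z.1 1))) ^ n| ≤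
      (1 / 2) * ((2 * C) ^ 2 * (2 * Real.pi * √(1 - σ ^ 2))⁻¹) *
        (8 * (n * (⌊(n : ℝ) ^ α⌋₊ * Real.exp (-w ^ 2 / (1 + σ)))) +
        4 * (n ^ 2 * (maxLateCorr ρ α n * Real.exp (-w ^ 2 / (1 + maxLateCorr ρ α n))))) := by
  have hn0 : n ≠ 0 := by omega
  have := hX.isProbabilityMeasure_rowLaw n
  have hr := hX.abs_corr_le_one hn0
  set Λ₁ : Fin n × Fin 2 → Fin n × Fin 2 → ℝ :=
    fun p q => cov[X n p.1 p.2, X n q.1 q.2; P] with hΛ₁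
  set Λ₀ : Fin n × Fin 2 → Fin n × Fin 2 → ℝ :=
    fun p q => if p.1 = q.1 then (if p.2 = q.2 then 1 else ρ₀ n) else 0 with hΛ₀
  have g₁ : IsCenteredGaussian (rowLaw P X n) Λ₁ :=
    isCenteredGaussian_map (X := fun (p : Fin n × Fin 2) => X n p.1 p.2) (hX.gaussian n)
      fun p => hX.mean_zero n p.1 p.2
  have g₀ : IsCenteredGaussian (blockLaw (Fin n) (bivLawPi (ρ₀ n))) Λ₀ :=
    (isCenteredGaussian_bivLawPi hr).blockLaw
  have hvar : ∀ p : Fin n × Fin 2, Λ₁ p p = 1 := fun p => by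
    simp only [hΛ₁]
    rw [covariance_self (hX.memLp _ _).aemeasurable, hX.unit_variance]
  have hblock : ∀ p q : Fin n × Fin 2, p.1 = q.1 → Λ₁ p q = Λ₀ p q := by
    rintro ⟨k, i⟩ ⟨l, j⟩ hkl
    simp only at hkl
    subst hkl
    by_cases hij : i = j
    · subst hij
      rw [hvar]; simp [hΛ₀]
    · simp only [hΛ₁, hΛ₀, if_true, if_neg hij]
      fin_cases i <;> fin_cases j
      · exact absurd rfl hij
      · exact hX.corr_same n k
      · rw [covariance_comm]; exact hX.corr_same n k
      · exact absurd rfl hij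
  have hoff0 : ∀ p q : Fin n × Fin 2, p.1 ≠ q.1 → Λ₀ p q = 0 := fun p q h => if_neg h
  have hoff : ∀ p q : Fin n × Fin 2, p.1 ≠ q.1 →
      Λ₁ p q = ρ p.2 q.2 (((p.1 : ℕ) : ℤ) - ((q.1 : ℕ) : ℤ)).natAbs n := fun p q h =>
    hX.corr_lag n p.1 q.1 p.2 q.2 h
  have hoffle : ∀ p q : Fin n × Fin 2, p.1 ≠ q.1 → |Λ₁ p q| ≤ σ := by
    intro p q h
    rw [hoff p q h]
    have hne : (p.1 : ℕ) ≠ (q.1 : ℕ) := fun h' => h (Fin.ext h')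
    have hp := p.1.isLt
    have hq := q.1.isLt
    exact hρσ _ _ _ (by omega) (by omega)
  have hcomp := normal_comparison hC0 hC g₁ g₀ hvar (fun p => by simp [hΛ₀])
    (fun p q => covariance_comm _ _)
    (fun p q => by simp only [hΛ₀, eq_comm]) hσ
    (fun p q h => by
      have hpq : p.1 ≠ q.1 := fun h' => h (hblock p q h')
      exact ⟨hoff0 p q hpq, hoffle p q hpq⟩)
    (a := fun p => -normLevel n (z.2 p.2)) (b := fun p => normLevel n (z.1 p.2)) hw
    (fun p => by rw [abs_neg]; exact (hz2 _).trans (le_abs_self _))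
    (fun p => (hz1 _).trans (le_abs_self _))
  rw [← hX.real_extremesEvent hn0,
    blockLaw_real_pi (bivLawPi (ρ₀ n))
      (s := fun i => Set.Ioc (-normLevel n (z.2 i)) (normLevel n (z.1 i)))
      (fun i : Fin 2 => measurableSet_Ioc),
    bivLawPi_real_pi _ (fun i : Fin 2 => measurableSet_Ioc), Fintype.card_fin] at hcomp
  refine hcomp.trans ?_
  rw [mul_assoc (1 / 2 : ℝ)]
  refine mul_le_mul_of_nonneg_left (a := (1 / 2 : ℝ)) ?_ (by norm_num)
  have hsum := sum_abs_mul_exp_le (ρ := ρ) (α := α) (w := w) hρσ hσ.le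
    (D := fun p q => Λ₁ p q - Λ₀ p q)
    (fun p q h => sub_eq_zero.2 (hblock p q h))
    (fun p q h => by simp only [hoff0 p q h, sub_zero]; exact hoff p q h)
  have hK : 0 ≤ (2 * C) ^ 2 * (2 * Real.pi * √(1 - σ ^ 2))⁻¹ := by positivity
  refine le_trans (le_of_eq ?_) (mul_le_mul_of_nonneg_left hsum hK)
  rw [Finset.mul_sum]
  refine Finset.sum_congr rfl fun p _ => ?_
  rw [Finset.mul_sum]
  refine Finset.sum_congr rfl fun q _ => ?_
  by_cases hpq : p.1 = q.1
  · rw [hblock p q hpq]; simp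
  · rw [hoff0 p q hpq]; simp only [sub_zero]; ring

lemma IsStationaryGaussianArray.tendsto_real_extremesEvent [IsProbabilityMeasure P]
    (hX : IsStationaryGaussianArray P X ρ₀ ρ) (hA : WeakDependence ρ) {lam : ℝ≥0∞}
    (hlam : HuslerReissCondition ρ₀ lam)
    (hneg : lam = ⊤ → Tendsto (fun n : ℕ => (1 + ρ₀ n) * Real.log n) atTop atTop)
    (z : (Fin 2 → ℝ) × (Fin 2 → ℝ)) :
    Tendsto (fun n => P.real (extremesEvent X n z)) atTop
      (𝓝 (huslerReissCDF lam (z.1 0) (z.1 1) * huslerReissCDF lam (z.2 0) (z.2 1))) := by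
  obtain ⟨C, hC0, hC⟩ := exists_bound_deriv_smoothTransition
  obtain ⟨σ, α, hlub, hσ, -, hα, hlim⟩ := hA
  have hρσ : ∀ n, 2 ≤ n → ∀ k i j, 1 ≤ k → k < n → |ρ i j k n| ≤ σ := fun n hn k i j h1 h2 =>
    hlub.1 ⟨n, k, i, j, hn, h1, h2, rfl⟩
  -- Lag `1` in row `2` supplies one absolute value below `σ`.
  have hσ0 : 0 ≤ σ := (abs_nonneg _).trans (hρσ 2 le_rfl 1 0 0 le_rfl one_lt_two)
  have hr : ∀ᶠ n in atTop, |ρ₀ n| ≤ 1 := by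
    filter_upwards [eventually_ne_atTop 0] with n hn
    exact hX.abs_corr_le_one hn
  have hmain := hlam.tendsto_bivLaw_rect_pow hr (hlam.tendsto_one_add_atTop hr hneg)
    (z.1 0) (z.1 1) (z.2 0) (z.2 1)
  -- `u_n(z₀)` lies below all four levels and is eventually positive; it serves as `w` in the
  -- comparison.
  set z₀ : ℝ := min (min (z.1 0) (z.1 1)) (min (z.2 0) (z.2 1)) with hz₀
  have hz1 : ∀ i, z₀ ≤ z.1 i := by
    rw [Fin.forall_fin_two]; simp [hz₀]
  have hz2 : ∀ i, z₀ ≤ z.2 i := by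
    rw [Fin.forall_fin_two]; simp [hz₀]
  have hbound := (((tendsto_early_terms hσ0 hα z₀).const_mul 8).add
    ((tendsto_late_terms (fun n => NNReal.coe_nonneg _) hlim z₀).const_mul 4)).const_mul
      ((1 / 2) * ((2 * C) ^ 2 * (2 * Real.pi * √(1 - σ ^ 2))⁻¹))
  simp only [mul_zero, add_zero] at hbound
  have hdiff := squeeze_zero_norm' (f := fun n => P.real (extremesEvent X n z) -
    (bivLaw (ρ₀ n)).real
      (Set.Ioc (-normLevel n (z.2 0)) (normLevel n (z.1 0)) ×ˢ
        Set.Ioc (-normLevel n (z.2 1)) (normLevel n (z.1 1))) ^ n) (by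
    filter_upwards [eventually_ge_atTop 2, eventually_neg_normLevel_lt z₀ z₀] with n hn hpos
    have hmono := (normLevel_strictMono hn).monotone
    exact hX.abs_real_sub_pow_le hC0 hC hn (hρσ n hn) hσ (by linarith) z
      (fun i => hmono (hz1 i)) (fun i => hmono (hz2 i))) hbound
  have := hdiff.add hmain
  rw [zero_add] at this
  refine this.congr fun n => ?_
  ring

end Array

/-! ### From pointwise to uniform convergence -/

section Uniformity
variable {ι : Type*} [Fintype ι]

/-- Pointwise convergence of monotone functions to a continuous limit is uniform on compacts. -/
lemma IsCompact.eventually_forall_abs_sub_lt_of_monotone {F : ℕ → (ι → ℝ) → ℝ} {G : (ι → ℝ) → ℝ}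
    (hmono : ∀ᶠ n in atTop, Monotone (F n)) (hG : Continuous G)
    (hlim : ∀ z, Tendsto (fun n => F n z) atTop (𝓝 (G z))) {s : Set (ι → ℝ)} (hs : IsCompact s)
    {ε : ℝ} (hε : 0 < ε) : ∀ᶠ n in atTop, ∀ z ∈ s, |F n z - G z| < ε := by
  refine hs.induction_on (p := fun t => ∀ᶠ n in atTop, ∀ z ∈ t, |F n z - G z| < ε) ?_ ?_ ?_ ?_
  · simp
  · intro t u htu h
    filter_upwards [h] with n hn z hz
    exact hn z (htu hz)
  · intro t u ht hu
    filter_upwards [ht, hu] with n h1 h2 z hz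
    exact hz.elim (h1 z) (h2 z)
  · intro z _
    obtain ⟨δ, hδ, hball⟩ := Metric.continuousAt_iff'.1 hG.continuousAt (ε / 3) (by positivity)
      |> Metric.nhds_basis_closedBall.mem_iff.1
    refine ⟨Metric.closedBall z δ, mem_nhdsWithin_of_mem_nhds (Metric.closedBall_mem_nhds z hδ), ?_⟩
    -- In the sup metric the corners `z ± δ` belong to the ball and bracket all its points, so
    -- convergence at these two corners controls `F n` on the whole ball.
    have hup : (fun i => z i + δ) ∈ Metric.closedBall z δ := by
      rw [Metric.mem_closedBall, dist_pi_le_iff hδ.le]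
      intro i; simp [abs_of_pos hδ]
    have hlo : (fun i => z i - δ) ∈ Metric.closedBall z δ := by
      rw [Metric.mem_closedBall, dist_pi_le_iff hδ.le]
      intro i; simp [abs_of_pos hδ]
    have hup' := hball hup
    have hlo' := hball hlo
    simp only [Set.mem_ofPred_eq, Real.dist_eq] at hup' hlo'
    filter_upwards [hmono, (hlim fun i => z i + δ).eventually_lt_const
        (show G (fun i => z i + δ) < G (fun i => z i + δ) + ε / 3 by linarith),
      (hlim fun i => z i - δ).eventually_const_lt
        (show G (fun i => z i - δ) - ε / 3 < G (fun i => z i - δ) by linarith)] with n hn h1 h2 w hw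
    have hGw := hball hw
    simp only [Set.mem_ofPred_eq, Real.dist_eq] at hGw
    have hwi : ∀ i, |w i - z i| ≤ δ := fun i => by
      rw [← Real.dist_eq]; exact (dist_le_pi_dist w z i).trans hw
    have m1 : F n w ≤ F n fun i => z i + δ := hn fun i => by
      have := (abs_le.1 (hwi i)).2; linarith
    have m2 : (F n fun i => z i - δ) ≤ F n w := hn fun i => by
      have := (abs_le.1 (hwi i)).1; linarith
    rw [abs_lt] at *
    constructor <;> linarith [hup'.1, hup'.2, hlo'.1, hlo'.2, hGw.1, hGw.2]

/-- Pólya's theorem: pointwise convergence of distribution functions to a continuous one is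
uniform. -/
lemma eventually_forall_abs_sub_le_of_monotone [DecidableEq ι] {F : ℕ → (ι → ℝ) → ℝ}
    {G : (ι → ℝ) → ℝ} (hmono : ∀ᶠ n in atTop, Monotone (F n)) (hnonneg : ∀ n z, 0 ≤ F n z)
    (hinf : ∀ᶠ n in atTop, ∀ z w, F n z - F n (z ⊓ w) ≤ 1 - F n w) (hG : Continuous G)
    (hlim : ∀ z, Tendsto (fun n => F n z) atTop (𝓝 (G z)))
    (htop : Tendsto (fun K : ℝ => G fun _ => K) atTop (𝓝 1)) {g : ℝ → ℝ}
    (hg : Tendsto g atBot (𝓝 0)) (hGg : ∀ z i, G z ≤ g (z i)) {ε : ℝ} (hε : 0 < ε) :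
    ∀ᶠ n in atTop, ∀ z, |F n z - G z| ≤ ε := by
  have hGmono : Monotone G := fun z w hzw =>
    le_of_tendsto_of_tendsto (hlim z) (hlim w) (by filter_upwards [hmono] with n hn using hn hzw)
  have hGnn : ∀ z, 0 ≤ G z := fun z => ge_of_tendsto' (hlim z) fun n => hnonneg n z
  have hGinf : ∀ z w, G z - G (z ⊓ w) ≤ 1 - G w := fun z w =>
    le_of_tendsto_of_tendsto ((hlim z).sub (hlim (z ⊓ w))) ((hlim w).const_sub 1)
      (by filter_upwards [hinf] with n hn using hn z w)
  -- `K` is chosen so that `G` misses mass less than `ε / 4` above the corner `(K, …, K)`, and is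
  -- below `ε / 4` as soon as one coordinate is at most `-K`. The property `hinf`, in essence `ℙ(A \
  -- B) ≤ 1 - ℙ(B)`, then allows every `z` to be truncated at `K`.
  obtain ⟨K, hK1, hK2⟩ := ((htop.eventually_const_lt (show 1 - ε / 4 < 1 by linarith)).and
    ((hg.comp tendsto_neg_atTop_atBot).eventually_lt_const (show 0 < ε / 4 by positivity))).exists
  simp only [Function.comp] at hK2
  set top : ι → ℝ := fun _ => K with htopdef
  -- A truncated point outside the cube lies below some `bot i`, so finitely many pointwise limits
  -- handle all of them.
  set bot : ι → ι → ℝ := fun i => Function.update top i (-K) with hbot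
  have hbotG : ∀ i, G (bot i) < ε / 4 := fun i =>
    (hGg (bot i) i).trans_lt (by simpa [hbot] using hK2)
  have hcompact := IsCompact.eventually_forall_abs_sub_lt_of_monotone hmono hG hlim
    (isCompact_Icc (a := fun _ : ι => -K) (b := top)) (show 0 < ε / 4 by positivity)
  have hbotF : ∀ᶠ n in atTop, ∀ i, F n (bot i) < ε / 4 :=
    eventually_all.2 fun i => (hlim (bot i)).eventually_lt_const (hbotG i)
  filter_upwards [hmono, hinf, hcompact, hbotF, (hlim top).eventually_const_lt hK1] with
    n hm hi hc hb ht z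
  have f1 : F n (z ⊓ top) ≤ F n z := hm inf_le_left
  have f2 : F n z - F n (z ⊓ top) < ε / 4 := (hi z top).trans_lt (by linarith)
  have g1 : G (z ⊓ top) ≤ G z := hGmono inf_le_left
  have g2 : G z - G (z ⊓ top) < ε / 4 := (hGinf z top).trans_lt (by linarith)
  have key : |F n (z ⊓ top) - G (z ⊓ top)| < ε / 4 := by
    by_cases hz : ∀ i, -K ≤ (z ⊓ top) i
    · exact hc _ ⟨hz, inf_le_right⟩
    · push Not at hz
      obtain ⟨i, hi'⟩ := hz
      have hle : z ⊓ top ≤ bot i := by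
        intro j
        by_cases hj : j = i
        · subst hj; simpa [hbot] using hi'.le
        · simp [hbot, Function.update_of_ne hj]
      have := hm hle
      have := hGmono hle
      rw [abs_lt]
      constructor <;> linarith [hnonneg n (z ⊓ top), hGnn (z ⊓ top), hb i, hbotG i]
  rw [abs_lt] at key
  rw [abs_le]
  constructor <;> linarith [key.1, key.2]

end Uniformity

/-! ### Regularity of the limit distribution -/

section LimitLaw

lemma tailLimit_nonneg (lam : ℝ≥0∞) (x y : ℝ) : 0 ≤ tailLimit lam x y :=
  integral_nonneg fun _ => mul_nonneg (Real.exp_pos _).le measureReal_nonneg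

lemma tailLimit_le (lam : ℝ≥0∞) (x y : ℝ) : tailLimit lam x y ≤ Real.exp (-x) := by
  rw [← integral_exp_neg_Ioi]
  exact integral_mono_of_nonneg
    (ae_of_all _ fun _ => mul_nonneg (Real.exp_pos _).le measureReal_nonneg)
    (integrableOn_exp_neg_Ioi x)
    (ae_of_all _ fun _ => mul_le_of_le_one_right (Real.exp_pos _).le measureReal_le_one)

lemma huslerReissCDF_comm (lam : ℝ≥0∞) (x y : ℝ) :
    huslerReissCDF lam x y = huslerReissCDF lam y x := by
  unfold huslerReissCDF
  split_ifs
  · exact min_comm _ _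
  · exact mul_comm _ _
  · congr 1; ring

lemma huslerReissCDF_nonneg (lam : ℝ≥0∞) (x y : ℝ) : 0 ≤ huslerReissCDF lam x y := by
  rw [huslerReissCDF_eq_exp]; exact (Real.exp_pos _).le

lemma huslerReissCDF_le_right (lam : ℝ≥0∞) (x y : ℝ) : huslerReissCDF lam x y ≤ gumbelCDF y := by
  rw [huslerReissCDF_eq_exp, gumbelCDF, Real.exp_le_exp]
  linarith [tailLimit_nonneg lam x y]

lemma huslerReissCDF_le_left (lam : ℝ≥0∞) (x y : ℝ) : huslerReissCDF lam x y ≤ gumbelCDF x := by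
  rw [huslerReissCDF_comm]; exact huslerReissCDF_le_right lam y x

lemma gumbelCDF_le_one (x : ℝ) : gumbelCDF x ≤ 1 := by
  rw [gumbelCDF, Real.exp_le_one_iff]; linarith [Real.exp_pos (-x)]

lemma huslerReissCDF_le_one (lam : ℝ≥0∞) (x y : ℝ) : huslerReissCDF lam x y ≤ 1 :=
  (huslerReissCDF_le_left lam x y).trans (gumbelCDF_le_one x)

lemma continuous_gumbelCDF : Continuous gumbelCDF := by
  unfold gumbelCDF; fun_prop

lemma continuous_huslerReissCDF (lam : ℝ≥0∞) :
    Continuous fun p : ℝ × ℝ => huslerReissCDF lam p.1 p.2 := by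
  have h1 := continuous_gumbelCDF
  have h2 : Continuous stdNormalCDF :=
    continuous_iff_continuousAt.2 fun z => (hasDerivAt_stdNormalCDF z).continuousAt
  unfold huslerReissCDF
  split_ifs <;> fun_prop

lemma tendsto_gumbelCDF_atBot : Tendsto gumbelCDF atBot (𝓝 0) :=
  Real.tendsto_exp_neg_atTop_nhds_zero.comp
    (Real.tendsto_exp_atTop.comp tendsto_neg_atBot_atTop)

lemma tendsto_huslerReissCDF_diag_atTop (lam : ℝ≥0∞) :
    Tendsto (fun K : ℝ => huslerReissCDF lam K K) atTop (𝓝 1) := by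
  have h1 : Tendsto (fun K : ℝ => Real.exp (-(Real.exp (-K) + Real.exp (-K)))) atTop (𝓝 1) := by
    have h := Real.tendsto_exp_neg_atTop_nhds_zero
    have := (Real.continuous_exp.tendsto _).comp (h.add h).neg
    simpa [Function.comp_def] using this
  refine tendsto_of_tendsto_of_tendsto_of_le_of_le h1 tendsto_const_nhds (fun K => ?_)
    fun K => huslerReissCDF_le_one lam K K
  simp only
  rw [huslerReissCDF_eq_exp, Real.exp_le_exp]
  linarith [tailLimit_le lam K K]

end LimitLaw

/-! ### Uniform convergence -/

theorem theorem2p1 {Ω : Type*} [MeasurableSpace Ω] (P : Measure Ω) [IsProbabilityMeasure P]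
    (X : (n : ℕ) → Fin n → Fin 2 → Ω → ℝ) (ρ₀ : ℕ → ℝ) (ρ : Fin 2 → Fin 2 → ℕ → ℕ → ℝ)
    (hX : IsStationaryGaussianArray P X ρ₀ ρ) (hA : WeakDependence ρ)
    (lam : ℝ≥0∞) (hlam : HuslerReissCondition ρ₀ lam)
    (hneg : lam = ⊤ → Tendsto (fun n : ℕ => (1 + ρ₀ n) * Real.log n) atTop atTop) :
    Tendsto
      (fun n : ℕ => ⨆ z : (Fin 2 → ℝ) × (Fin 2 → ℝ),
        |P.real {ω | ∀ i : Fin 2, -normLevel n (z.2 i) < rowMin X n i ω ∧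
              rowMin X n i ω ≤ rowMax X n i ω ∧ rowMax X n i ω ≤ normLevel n (z.1 i)}
          - huslerReissCDF lam (z.1 0) (z.1 1) * huslerReissCDF lam (z.2 0) (z.2 1)|)
      atTop (𝓝 0) := by
  -- The constraint `-u_n(y) < m` relaxes as `y` grows, so in all four bounds `F n` behaves like the
  -- distribution function of the maxima and the negated minima.
  set F : ℕ → (Fin 2 ⊕ Fin 2 → ℝ) → ℝ := fun n z =>
    P.real (extremesEvent X n (fun i => z (Sum.inl i), fun i => z (Sum.inr i))) with hF
  set G : (Fin 2 ⊕ Fin 2 → ℝ) → ℝ := fun z =>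
    huslerReissCDF lam (z (Sum.inl 0)) (z (Sum.inl 1)) *
      huslerReissCDF lam (z (Sum.inr 0)) (z (Sum.inr 1)) with hG
  have hc := continuous_huslerReissCDF lam
  have hGc : Continuous G := by
    have h1 : Continuous fun z : Fin 2 ⊕ Fin 2 → ℝ =>
        huslerReissCDF lam (z (Sum.inl 0)) (z (Sum.inl 1)) :=
      hc.comp (f := fun z : Fin 2 ⊕ Fin 2 → ℝ => (z (Sum.inl 0), z (Sum.inl 1))) (by fun_prop)
    have h2 : Continuous fun z : Fin 2 ⊕ Fin 2 → ℝ =>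
        huslerReissCDF lam (z (Sum.inr 0)) (z (Sum.inr 1)) :=
      hc.comp (f := fun z : Fin 2 ⊕ Fin 2 → ℝ => (z (Sum.inr 0), z (Sum.inr 1))) (by fun_prop)
    exact h1.mul h2
  -- Meets of bounds correspond to intersections of events; both monotonicity and `hinf` follow from
  -- this.
  have hevent : ∀ {n : ℕ}, 2 ≤ n → ∀ z w : Fin 2 ⊕ Fin 2 → ℝ,
      extremesEvent X n (fun i => (z ⊓ w) (Sum.inl i), fun i => (z ⊓ w) (Sum.inr i)) =
      extremesEvent X n (fun i => z (Sum.inl i), fun i => z (Sum.inr i)) ∩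
        extremesEvent X n (fun i => w (Sum.inl i), fun i => w (Sum.inr i)) := by
    intro n hn z w
    have hm := (normLevel_strictMono hn).monotone
    ext ω
    rw [Set.mem_inter_iff, mem_extremesEvent (by omega), mem_extremesEvent (by omega),
      mem_extremesEvent (by omega)]
    simp only [Pi.inf_apply, hm.map_min, ← forall_and, Set.mem_Ioc, le_inf_iff, neg_lt, lt_inf_iff]
    refine forall_congr' fun k => forall_congr' fun i => ?_
    tauto
  have hmono : ∀ᶠ n in atTop, Monotone (F n) := by
    filter_upwards [eventually_ge_atTop 2] with n hn z w hzw
    have := hevent hn z w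
    rw [inf_eq_left.2 hzw] at this
    simp only [hF]
    rw [this]
    exact measureReal_mono Set.inter_subset_right
  have hinf : ∀ᶠ n in atTop, ∀ z w, F n z - F n (z ⊓ w) ≤ 1 - F n w := by
    filter_upwards [eventually_ge_atTop 2] with n hn z w
    -- A Gaussian law gives only almost everywhere measurability of the row, hence a null measurable
    -- event.
    have hnull : NullMeasurableSet
        (extremesEvent X n (fun i => w (Sum.inl i), fun i => w (Sum.inr i))) P := by
      have : extremesEvent X n (fun i => w (Sum.inl i), fun i => w (Sum.inr i)) =
          (fun ω (p : Fin n × Fin 2) => X n p.1 p.2 ω) ⁻¹' (Set.univ.pi fun p : Fin n × Fin 2 =>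
            Set.Ioc (-normLevel n (w (Sum.inr p.2))) (normLevel n (w (Sum.inl p.2)))) := by
        ext ω
        rw [mem_extremesEvent (by omega)]
        simp only [Set.mem_preimage, Set.mem_univ_pi, Prod.forall]
      rw [this]
      exact (hX.gaussian n).aemeasurable.nullMeasurable
        (MeasurableSet.univ_pi fun p => measurableSet_Ioc)
    simp only [hF]
    rw [hevent hn, ← probReal_compl_eq_one_sub₀ hnull, ← measureReal_inter_add_sdiff₀
      (s := extremesEvent X n (fun i => z (Sum.inl i), fun i => z (Sum.inr i))) hnull,
      add_sub_cancel_left]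
    exact measureReal_mono fun ω hω => hω.2
  have htop : Tendsto (fun K : ℝ => G fun _ => K) atTop (𝓝 1) := by
    have := (tendsto_huslerReissCDF_diag_atTop lam).mul (tendsto_huslerReissCDF_diag_atTop lam)
    rwa [mul_one] at this
  have hGg : ∀ z i, G z ≤ gumbelCDF (z i) := by
    intro z i
    have l1 : G z ≤ huslerReissCDF lam (z (Sum.inl 0)) (z (Sum.inl 1)) :=
      mul_le_of_le_one_right (huslerReissCDF_nonneg _ _ _) (huslerReissCDF_le_one _ _ _)
    have l2 : G z ≤ huslerReissCDF lam (z (Sum.inr 0)) (z (Sum.inr 1)) :=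
      mul_le_of_le_one_left (huslerReissCDF_nonneg _ _ _) (huslerReissCDF_le_one _ _ _)
    rcases i with i | i <;> fin_cases i
    · exact l1.trans (huslerReissCDF_le_left _ _ _)
    · exact l1.trans (huslerReissCDF_le_right _ _ _)
    · exact l2.trans (huslerReissCDF_le_left _ _ _)
    · exact l2.trans (huslerReissCDF_le_right _ _ _)
  rw [Metric.tendsto_atTop']
  intro ε hε
  have h := eventually_forall_abs_sub_le_of_monotone hmono (fun n z => measureReal_nonneg) hinf hGc
    (fun z => hX.tendsto_real_extremesEvent hA hlam hneg
      (fun i => z (Sum.inl i), fun i => z (Sum.inr i)))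
    htop tendsto_gumbelCDF_atBot hGg (half_pos hε)
  obtain ⟨N, hN⟩ := eventually_atTop.1 h
  refine ⟨N, fun n hn => ?_⟩
  rw [Real.dist_eq, sub_zero, abs_of_nonneg (Real.iSup_nonneg fun z => abs_nonneg _)]
  refine lt_of_le_of_lt (Real.iSup_le (fun z => ?_) (half_pos hε).le) (half_lt_self hε)
  exact hN n (le_of_lt hn) (Sum.elim z.1 z.2)
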